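/- Let $a,c,r>0$, let $\mathcal H$ be the circular one-sheet hyperboloid $\frac{x^2}{a^2}+\frac{y^2}{a^2}-\frac{z^2}{c^2}=1$ and let $\mathcal S$ be the sphere $(x-x_c)^2+(y-y_c)^2+(z-z_c)^2=r^2$. Let $H$ and $S$ be their symmetric $4\times4$ matrices, $$H=\begin{pmatrix}a^{-2}&0&0&0\\0&a^{-2}&0&0\\0&0&-c^{-2}&0\\0&0&0&-1\end{pmatrix},\qquad S=\begin{pmatrix}1&0&0&-x_c\\0&1&0&-y_c\\0&0&1&-z_c\\-x_c&-y_c&-z_c&-r^2+x_c^2+y_c^2+z_c^2\end{pmatrix},$$ so that, with $X=(x,y,z,1)^t$, the surfaces are $X^tHX=0$ and $X^tSX=0$. A point $X$ is interior (exterior) to $\mathcal H$ if $X^tHX<0$ ($X^tHX>0$). The surfaces are in contact if they have a common point, and tangent at a common point $X$ if they have the same tangent plane there. Let $f(\lambda)=\det(\lambda H+S)$. It has degree $4$ and $-a^2$ is one of its roots; "the roots are $-a^2,\lambda_2,\lambda_3,\lambda_4$" means that these are all its complex roots, with multiplicity, in a suitable labelling. Then: - (I) every point of $\mathcal S$ is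 interior to $\mathcal H$ if and only if the roots are $-a^2,\lambda_2,\lambda_3,\lambda_4\in\mathbb R$ with $-a^2\le\lambda_2<\lambda_3<0<\lambda_4$; - (E) every point of $\mathcal S$ is exterior to $\mathcal H$ if and only if the roots are $-a^2,\lambda_2,\lambda_3,\lambda_4\in\mathbb R$ with $0<\lambda_2<\lambda_3\le c^2\le\lambda_4$; - (TI) $\mathcal S$ and $\mathcal H$ are tangent at one point and have no other common point, and the centre of $\mathcal S$ is interior to $\mathcal H$, if and only if the roots are $-a^2,\lambda_2,\lambda_3,\lambda_4\in\mathbb R$ with $-a^2<\lambda_2=\lambda_3<0<\lambda_4$; - (TE) $\mathcal S$ and $\mathcal H$ are tangent at one point and have no other common point, and the centre of $\mathcal S$ is exterior to $\mathcal H$, if and only if the roots are $-a^2,\lambda_2,\lambda_3,\lambda_4\in\mathbb R$ with either $0<\lambda_2=\lambda_3<\lambda_4$ and $\lambda_3<c^2$, or $\lambda_2=\lambda_3=\lambda_4=c^2$; - (C) $\mathcal S$ and $\mathcal H$ are in contact, are nowhere tangent, and $\mathcal S\cap\mathcal H$ is connected, if and only if the roots are $-a^2,\lambda_2,\lambda_3,\lambda_4$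 with $\lambda_2=\overline{\lambda_3}\in\mathbb C\setminus\mathbb R$ and $0<\lambda_4\in\mathbb R$. Moreover, if $r<a$ and $ar<c^2$, then the last three equivalences also hold in the following form: $\mathcal S$ and $\mathcal H$ are tangent at some point and the centre of $\mathcal S$ is interior to $\mathcal H$ if and only if the roots are real with $-a^2<\lambda_2=\lambda_3<0<\lambda_4$; they are tangent at some point and the centre is exterior if and only if the roots are real with $0<\lambda_2=\lambda_3<\lambda_4$; they are in contact and nowhere tangent if and only if $\lambda_2=\overline{\lambda_3}\in\mathbb C\setminus\mathbb R$ and $0<\lambda_4\in\mathbb R$. -/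

import Mathlib

open scoped Matrix

/-- The matrix of the circular hyperboloid of one sheet `x²/a² + y²/a² - z²/c² = 1`. -/
noncomputable def hyperboloidMatrix (a c : ℝ) : Matrix (Fin 4) (Fin 4) ℝ :=
  !![(a ^ 2)⁻¹, 0, 0, 0;
     0, (a ^ 2)⁻¹, 0, 0;
     0, 0, -(c ^ 2)⁻¹, 0;
     0, 0, 0, -1]

/-- The matrix of the sphere with centre `p` and radius `r`. -/
def sphereMatrix (p : Fin 3 → ℝ) (r : ℝ) : Matrix (Fin 4) (Fin 4) ℝ :=
  !![1, 0, 0, -p 0;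
     0, 1, 0, -p 1;
     0, 0, 1, -p 2;
     -p 0, -p 1, -p 2, -r ^ 2 + p 0 ^ 2 + p 1 ^ 2 + p 2 ^ 2]

/-- Homogeneous coordinates `(x, y, z, 1)` of a point of space. -/
def homCoord (q : Fin 3 → ℝ) : Fin 4 → ℝ := ![q 0, q 1, q 2, 1]

/-- The value `Xᵗ M X` of the quadratic form of `M` at the point `q`, where `X = (q, 1)`. -/
def quadValue (M : Matrix (Fin 4) (Fin 4) ℝ) (q : Fin 3 → ℝ) : ℝ :=
  homCoord q ⬝ᵥ (M *ᵥ homCoord q)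

/-- The surface (set of points of space) with equation `Xᵗ M X = 0`. -/
def quadricSurface (M : Matrix (Fin 4) (Fin 4) ℝ) : Set (Fin 3 → ℝ) :=
  {q | quadValue M q = 0}

/-- The point `q` is interior to the quadric `M`. -/
def IsInteriorPoint (M : Matrix (Fin 4) (Fin 4) ℝ) (q : Fin 3 → ℝ) : Prop :=
  quadValue M q < 0

/-- The point `q` is exterior to the quadric `M`. -/
def IsExteriorPoint (M : Matrix (Fin 4) (Fin 4) ℝ) (q : Fin 3 → ℝ) : Prop :=
  0 < quadValue M q

/-- The quadrics `M` and `N` are in contact: they have a common point. -/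
def InContact (M N : Matrix (Fin 4) (Fin 4) ℝ) : Prop :=
  ∃ q, quadValue M q = 0 ∧ quadValue N q = 0

/-- The quadrics `M` and `N` are tangent at `q`: `q` lies on both of them and they have the same
tangent plane there. -/
def TangentAt (M N : Matrix (Fin 4) (Fin 4) ℝ) (q : Fin 3 → ℝ) : Prop :=
  (quadValue M q = 0 ∧ quadValue N q = 0) ∧
    ∀ Y : Fin 4 → ℝ, Y ⬝ᵥ (M *ᵥ homCoord q) = 0 ↔ Y ⬝ᵥ (N *ᵥ homCoord q) = 0

/-- The quadrics `M` and `N` are tangent (at some point). -/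
def AreTangent (M N : Matrix (Fin 4) (Fin 4) ℝ) : Prop :=
  ∃ q, TangentAt M N q

/-- The quadrics `M` and `N` are tangent at one point and have no other point in common. -/
def SimplyTangent (M N : Matrix (Fin 4) (Fin 4) ℝ) : Prop :=
  ∃ q, TangentAt M N q ∧ quadricSurface M ∩ quadricSurface N = {q}

/-- Type I: every point of the sphere is interior to the hyperboloid. -/
def TypeI (a c r : ℝ) (p : Fin 3 → ℝ) : Prop :=
  ∀ q ∈ quadricSurface (sphereMatrix p r), IsInteriorPoint (hyperboloidMatrix a c) q

/-- Type E: every point of the sphere is exterior to the hyperboloid. -/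
def TypeE (a c r : ℝ) (p : Fin 3 → ℝ) : Prop :=
  ∀ q ∈ quadricSurface (sphereMatrix p r), IsExteriorPoint (hyperboloidMatrix a c) q

/-- Type TI: tangency at one point, without further contact, and the centre of the sphere is
interior to the hyperboloid. -/
def TypeTI (a c r : ℝ) (p : Fin 3 → ℝ) : Prop :=
  SimplyTangent (hyperboloidMatrix a c) (sphereMatrix p r) ∧
    IsInteriorPoint (hyperboloidMatrix a c) p

/-- Type TE: tangency at one point, without further contact, and the centre of the sphere is
exterior to the hyperboloid. -/
def TypeTE (a c r : ℝ) (p : Fin 3 → ℝ) : Prop :=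
  SimplyTangent (hyperboloidMatrix a c) (sphereMatrix p r) ∧
    IsExteriorPoint (hyperboloidMatrix a c) p

/-- Type C: there is contact, no point of tangency, and the intersection is connected. -/
def TypeC (a c r : ℝ) (p : Fin 3 → ℝ) : Prop :=
  InContact (hyperboloidMatrix a c) (sphereMatrix p r) ∧
    ¬ AreTangent (hyperboloidMatrix a c) (sphereMatrix p r) ∧
    IsConnected (quadricSurface (hyperboloidMatrix a c) ∩ quadricSurface (sphereMatrix p r))

/-- The characteristic polynomial `f(λ) = det (λ H + S)` of two quadrics. -/
noncomputable def quadricCharPoly (H S : Matrix (Fin 4) (Fin 4) ℝ) : Polynomial ℝ :=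
  ((Polynomial.X : Polynomial ℝ) • H.map Polynomial.C + S.map Polynomial.C).det

/-- The complex roots, with multiplicity, of the characteristic polynomial of the hyperboloid and
the sphere are `-a²`, `l₂`, `l₃`, `l₄`. -/
def HasRoots (a c r : ℝ) (p : Fin 3 → ℝ) (l₂ l₃ l₄ : ℂ) : Prop :=
  ((quadricCharPoly (hyperboloidMatrix a c) (sphereMatrix p r)).map (algebraMap ℝ ℂ)).roots =
    {-(a : ℂ) ^ 2, l₂, l₃, l₄}

/-! Write `S` and `H` for the equations `sphereEq` and `hypEq`, and `g` for `reducedCubic`.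
Rotational symmetry splits `λ + a²` off the characteristic polynomial, and the other three roots are
those of `g`. The link with geometry is the pencil `L_t = a²c²S + tH`. Its completed squares
(`mul_pencilEq`) have horizontal weight of the sign of `t + a²`, vertical weight of the sign of `c²
- t`, and a constant governed by `g(t)`. For `-a² < t < c²`, `L_t` is therefore positive everywhere
exactly when `g(t) > 0`, and a zero of `g` there makes `L_t` nonnegative with a single zero.

Types I and E: on the sphere `L_t = tH`, so a positive member fixes the sign of `H`. Conversely, an
extremum of `H` on the sphere has a Lagrange multiplier satisfying a global second-order condition,
which produces such a member (`forall_hypEq_neg_iff`, `forall_hypEq_pos_iff`). The signs of `g` at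
`-a²`, `0`, `c²` turn `g(t) > 0` into root positions.

Tangency makes `t` a double root with third root at least `c²` (`TangentWith.reducedCubic_eq`). If
there is only one common point, `H` cannot change sign on the sphere, because a punctured sphere is
connected. The common point is then an extremum, and the multiplier gives the admissible range of
`t`.

Type C has two halves. If all roots are real, there is no contact, or a tangency, or one of two
exceptional root positions (`real_roots_cases`). In the exceptional positions the curve misses a
plane, while projection from the apex of a cone of the pencil pairs points across that plane, so the
curve is disconnected (`not_isPreconnected_of_roots`). If only one root is real, the curve is two
graphs over the set of heights where a quartic is nonnegative. A gap in that set would give the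
quartic four real roots; two pairings of them give distinct real roots of its resolvent, which is
`g` after a change of parameter (`ordConnected_curveTransversalSq`).

For a small sphere the product of the roots, `a²c²r²`, excludes both the nonsimple tangencies and
the exceptional positions. -/

/-- `a⁴c²/(t + a²)` times the characteristic polynomial `det (tH + S)`, a monic cubic. -/
def reducedCubic (a c r : ℝ) (p : Fin 3 → ℝ) (t : ℝ) : ℝ :=
  (t + a ^ 2) * (t - c ^ 2) * (t + r ^ 2) - (p 0 ^ 2 + p 1 ^ 2) * t * (t - c ^ 2)
    - p 2 ^ 2 * t * (t + a ^ 2)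

/-- The equation of the sphere. -/
def sphereEq (r : ℝ) (p q : Fin 3 → ℝ) : ℝ :=
  (q 0 - p 0) ^ 2 + (q 1 - p 1) ^ 2 + (q 2 - p 2) ^ 2 - r ^ 2

/-- The equation of the hyperboloid, with denominators cleared. -/
def hypEq (a c : ℝ) (q : Fin 3 → ℝ) : ℝ :=
  c ^ 2 * (q 0 ^ 2 + q 1 ^ 2) - a ^ 2 * q 2 ^ 2 - a ^ 2 * c ^ 2

/-! ### The matrix predicates in coordinates -/

lemma quadValue_sphereMatrix (p q : Fin 3 → ℝ) (r : ℝ) :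
    quadValue (sphereMatrix p r) q = sphereEq r p q := by
  simp [quadValue, sphereMatrix, homCoord, sphereEq, dotProduct, Matrix.mulVec, Fin.sum_univ_four]
  ring

lemma quadValue_hyperboloidMatrix {a c : ℝ} (ha : 0 < a) (hc : 0 < c) (q : Fin 3 → ℝ) :
    quadValue (hyperboloidMatrix a c) q = hypEq a c q / (a ^ 2 * c ^ 2) := by
  simp [quadValue, hyperboloidMatrix, homCoord, hypEq, dotProduct, Matrix.mulVec,
    Fin.sum_univ_four]
  field_simp
  ring

lemma mem_quadricSurface_sphereMatrix {p q : Fin 3 → ℝ} {r : ℝ} :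
    q ∈ quadricSurface (sphereMatrix p r) ↔ sphereEq r p q = 0 := by
  simp [quadricSurface, quadValue_sphereMatrix]

lemma quadValue_hyperboloidMatrix_eq_zero {a c : ℝ} (ha : 0 < a) (hc : 0 < c) (q : Fin 3 → ℝ) :
    quadValue (hyperboloidMatrix a c) q = 0 ↔ hypEq a c q = 0 := by
  rw [quadValue_hyperboloidMatrix ha hc, div_eq_zero_iff]
  have : a ^ 2 * c ^ 2 ≠ 0 := by positivity
  tauto

lemma mem_inter_quadricSurface {a c r : ℝ} (ha : 0 < a) (hc : 0 < c) {p q : Fin 3 → ℝ} :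
    q ∈ quadricSurface (hyperboloidMatrix a c) ∩ quadricSurface (sphereMatrix p r) ↔
      hypEq a c q = 0 ∧ sphereEq r p q = 0 := by
  simp [quadricSurface, quadValue_sphereMatrix, quadValue_hyperboloidMatrix_eq_zero ha hc]

lemma isInteriorPoint_hyperboloidMatrix {a c : ℝ} (ha : 0 < a) (hc : 0 < c) (q : Fin 3 → ℝ) :
    IsInteriorPoint (hyperboloidMatrix a c) q ↔ hypEq a c q < 0 := by
  rw [IsInteriorPoint, quadValue_hyperboloidMatrix ha hc, div_neg_iff]
  have : 0 < a ^ 2 * c ^ 2 := by positivity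
  constructor
  · rintro (h | h)
    · linarith
    · exact h.1
  · exact fun h => Or.inr ⟨h, this⟩

lemma isExteriorPoint_hyperboloidMatrix {a c : ℝ} (ha : 0 < a) (hc : 0 < c) (q : Fin 3 → ℝ) :
    IsExteriorPoint (hyperboloidMatrix a c) q ↔ 0 < hypEq a c q := by
  rw [IsExteriorPoint, quadValue_hyperboloidMatrix ha hc, div_pos_iff_of_pos_right (by positivity)]

lemma inContact_iff {a c r : ℝ} (ha : 0 < a) (hc : 0 < c) {p : Fin 3 → ℝ} :
    InContact (hyperboloidMatrix a c) (sphereMatrix p r) ↔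
      ∃ q, hypEq a c q = 0 ∧ sphereEq r p q = 0 := by
  simp [InContact, quadValue_sphereMatrix, quadValue_hyperboloidMatrix_eq_zero ha hc]

/-! ### The characteristic polynomial and its cubic factor -/

open Polynomial in
/-- The reduced cubic as a polynomial. -/
noncomputable def reducedPoly (a c r : ℝ) (p : Fin 3 → ℝ) : ℝ[X] :=
  (X + C (a ^ 2)) * (X - C (c ^ 2)) * (X + C (r ^ 2)) - C (p 0 ^ 2 + p 1 ^ 2) * X * (X - C (c ^ 2))
    - C (p 2 ^ 2) * X * (X + C (a ^ 2))

open Polynomial in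
lemma eval_reducedPoly (a c r : ℝ) (p : Fin 3 → ℝ) (t : ℝ) :
    (reducedPoly a c r p).eval t = reducedCubic a c r p t := by
  simp [reducedPoly, reducedCubic]

open Polynomial in
lemma quadricCharPoly_eq {a c r : ℝ} (ha : 0 < a) (hc : 0 < c) (p : Fin 3 → ℝ) :
    quadricCharPoly (hyperboloidMatrix a c) (sphereMatrix p r) =
      C ((a ^ 4 * c ^ 2)⁻¹) * ((X + C (a ^ 2)) * reducedPoly a c r p) := by
  apply Polynomial.funext
  intro t
  have h : (quadricCharPoly (hyperboloidMatrix a c) (sphereMatrix p r)).eval t =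
      (t • hyperboloidMatrix a c + sphereMatrix p r).det := by
    rw [quadricCharPoly, ← Polynomial.coe_evalRingHom, RingHom.map_det]
    congr 1
    ext i j
    simp [mul_comm t]
  rw [h, Matrix.det_succ_row_zero]
  simp [Fin.sum_univ_four, Matrix.det_fin_three, hyperboloidMatrix, sphereMatrix, reducedPoly,
    Fin.succAbove, Matrix.submatrix_apply]
  field_simp
  ring

-- Both sides determine each other because the polynomials are monic up to a constant: four roots
-- for degree four recover the product, and the common factor `X + a²` cancels.
open Polynomial in
lemma hasRoots_iff {a c r : ℝ} (ha : 0 < a) (hc : 0 < c) (p : Fin 3 → ℝ) (l₂ l₃ l₄ : ℂ) :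
    HasRoots a c r p l₂ l₃ l₄ ↔
      (reducedPoly a c r p).map (algebraMap ℝ ℂ) = (X - C l₂) * (X - C l₃) * (X - C l₄) := by
  have hk : (algebraMap ℝ ℂ) ((a ^ 4 * c ^ 2)⁻¹) ≠ 0 := by
    rw [_root_.map_ne_zero]; positivity
  have hX : ((X + C (a ^ 2) : ℝ[X]).map (algebraMap ℝ ℂ)) = X - C (-(a : ℂ) ^ 2) := by
    simp
  have hprod : (({-(a : ℂ) ^ 2, l₂, l₃, l₄} : Multiset ℂ).map fun z => X - C z).prod =
      (X - C (-(a : ℂ) ^ 2)) * ((X - C l₂) * (X - C l₃) * (X - C l₄)) := by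
    simp [mul_assoc]
  have hred : (reducedPoly a c r p).Monic ∧ (reducedPoly a c r p).natDegree = 3 := by
    have e : reducedPoly a c r p = (⟨1, a ^ 2 - c ^ 2 + r ^ 2 - (p 0 ^ 2 + p 1 ^ 2) - p 2 ^ 2,
        a ^ 2 * r ^ 2 - c ^ 2 * r ^ 2 - a ^ 2 * c ^ 2 + (p 0 ^ 2 + p 1 ^ 2) * c ^ 2
          - p 2 ^ 2 * a ^ 2, - a ^ 2 * c ^ 2 * r ^ 2⟩ : Cubic ℝ).toPoly := by
      simp only [reducedPoly, Cubic.toPoly, map_add, map_sub, map_mul, map_neg, map_pow, map_one]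
      ring
    rw [e]
    exact ⟨Cubic.monic_of_a_eq_one rfl, Cubic.natDegree_of_a_ne_zero one_ne_zero⟩
  rw [HasRoots, quadricCharPoly_eq ha hc, Polynomial.map_mul, Polynomial.map_C,
    Polynomial.roots_C_mul _ hk, Polynomial.map_mul, hX]
  have hm : ((X - C (-(a : ℂ) ^ 2)) * (reducedPoly a c r p).map (algebraMap ℝ ℂ)).Monic :=
    (monic_X_sub_C _).mul (hred.1.map _)
  constructor
  · intro h
    have hd : ((X - C (-(a : ℂ) ^ 2)) * (reducedPoly a c r p).map (algebraMap ℝ ℂ)).natDegree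
        = 4 := by
      rw [(monic_X_sub_C _).natDegree_mul (hred.1.map _), natDegree_X_sub_C,
        hred.1.natDegree_map, hred.2]
    have := prod_multiset_X_sub_C_of_monic_of_roots_card_eq hm (by rw [h, hd]; rfl)
    rw [h, hprod] at this
    exact (mul_left_cancel₀ (X_sub_C_ne_zero _) this).symm
  · intro h
    rw [h, ← hprod, roots_multiset_prod_X_sub_C]

open Polynomial in
lemma hasRoots_ofReal_iff {a c r : ℝ} (ha : 0 < a) (hc : 0 < c) (p : Fin 3 → ℝ) (l₂ l₃ l₄ : ℝ) :
    HasRoots a c r p l₂ l₃ l₄ ↔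
      ∀ t, reducedCubic a c r p t = (t - l₂) * (t - l₃) * (t - l₄) := by
  rw [hasRoots_iff ha hc]
  have : (X - C (l₂ : ℂ)) * (X - C (l₃ : ℂ)) * (X - C (l₄ : ℂ)) =
      ((X - C l₂) * (X - C l₃) * (X - C l₄)).map (algebraMap ℝ ℂ) := by simp
  rw [this, (Polynomial.map_injective _ (algebraMap ℝ ℂ).injective).eq_iff]
  constructor
  · intro h t
    rw [← eval_reducedPoly, h]; simp
  · intro h
    apply Polynomial.funext
    intro t
    rw [eval_reducedPoly, h]; simp

open Polynomial in
lemma hasRoots_conj_iff {a c r : ℝ} (ha : 0 < a) (hc : 0 < c) (p : Fin 3 → ℝ) (l : ℂ) (l₄ : ℝ) :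
    HasRoots a c r p ((starRingEnd ℂ) l) l l₄ ↔
      ∀ t, reducedCubic a c r p t = ((t - l.re) ^ 2 + l.im ^ 2) * (t - l₄) := by
  rw [hasRoots_iff ha hc]
  have : (X - C ((starRingEnd ℂ) l)) * (X - C l) * (X - C (l₄ : ℂ)) =
      (((X - C l.re) ^ 2 + C (l.im ^ 2)) * (X - C l₄)).map (algebraMap ℝ ℂ) := by
    have h1 : (starRingEnd ℂ) l + l = ((l.re + l.re : ℝ) : ℂ) := by
      rw [add_comm, Complex.add_conj, two_mul]
    have h2 : (starRingEnd ℂ) l * l = ((l.re ^ 2 + l.im ^ 2 : ℝ) : ℂ) := by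
      rw [mul_comm, Complex.mul_conj, Complex.normSq_apply]; push_cast; ring
    have h3 : (X - C ((starRingEnd ℂ) l)) * (X - C l) =
        X ^ 2 - C ((starRingEnd ℂ) l + l) * X + C ((starRingEnd ℂ) l * l) := by
      simp only [map_add, map_mul]; ring
    rw [h3, h1, h2]
    simp only [map_add, map_pow, Polynomial.map_mul, Polynomial.map_add,
      Polynomial.map_sub, Polynomial.map_pow, map_X, map_C, Complex.ofReal_add, Complex.ofReal_pow,
      Complex.coe_algebraMap]
    ring
  rw [this, (Polynomial.map_injective _ (algebraMap ℝ ℂ).injective).eq_iff]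
  constructor
  · intro h t
    rw [← eval_reducedPoly, h]; simp
  · intro h
    apply Polynomial.funext
    intro t
    rw [eval_reducedPoly, h]; simp

/-! ### Topology of the sphere -/

/-- The parametrization of the sphere by the Euclidean unit sphere. -/
def sphereParam (r : ℝ) (p : Fin 3 → ℝ) (x : EuclideanSpace ℝ (Fin 3)) : Fin 3 → ℝ :=
  fun i => p i + r * x i

lemma continuous_sphereParam (r : ℝ) (p : Fin 3 → ℝ) : Continuous (sphereParam r p) := by
  unfold sphereParam; fun_prop

lemma norm_eq_one_iff_fin_three (x : EuclideanSpace ℝ (Fin 3)) :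
    ‖x‖ = 1 ↔ x 0 ^ 2 + x 1 ^ 2 + x 2 ^ 2 = 1 := by
  rw [EuclideanSpace.norm_eq, Real.sqrt_eq_one, Fin.sum_univ_three]
  simp

lemma image_sphereParam {r : ℝ} (hr : 0 < r) (p : Fin 3 → ℝ) :
    sphereParam r p '' Metric.sphere 0 1 = {q | sphereEq r p q = 0} := by
  ext q
  simp only [Set.mem_image, mem_sphere_zero_iff_norm, norm_eq_one_iff_fin_three, Set.mem_ofPred_eq,
    sphereEq]
  constructor
  · rintro ⟨x, hx, rfl⟩
    simp only [sphereParam]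
    linear_combination r ^ 2 * hx
  · intro h
    refine ⟨WithLp.toLp 2 fun i => (q i - p i) / r, ?_, ?_⟩
    · simp only
      field_simp
      linear_combination h
    · ext i
      simp only [sphereParam]
      field_simp
      ring

lemma injective_sphereParam {r : ℝ} (hr : 0 < r) (p : Fin 3 → ℝ) :
    Function.Injective (sphereParam r p) := by
  intro x y h
  ext i
  have := congrFun h i
  simp only [sphereParam] at this
  exact mul_left_cancel₀ hr.ne' (add_left_cancel this)

lemma isCompact_sphereEq {r : ℝ} (hr : 0 < r) (p : Fin 3 → ℝ) :
    IsCompact {q | sphereEq r p q = 0} := by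
  rw [← image_sphereParam hr]
  exact (isCompact_sphere 0 1).image (continuous_sphereParam r p)

lemma isPreconnected_sphereEq {r : ℝ} (hr : 0 < r) (p : Fin 3 → ℝ) :
    IsPreconnected {q | sphereEq r p q = 0} := by
  rw [← image_sphereParam hr]
  refine (isPreconnected_sphere ?_ 0 1).image _ (continuous_sphereParam r p).continuousOn
  rw [← Module.finrank_eq_rank, finrank_euclideanSpace_fin]
  norm_num

/-- Inverse stereographic projection from the removed point exhibits the rest as a continuous image
of a plane. -/
lemma isPreconnected_sphereEq_diff {r : ℝ} (hr : 0 < r) (p q : Fin 3 → ℝ)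
    (hq : sphereEq r p q = 0) : IsPreconnected ({q | sphereEq r p q = 0} \ {q}) := by
  have hq' : q ∈ sphereParam r p '' Metric.sphere 0 1 := by rwa [image_sphereParam hr]
  obtain ⟨v, hv, rfl⟩ := hq'
  have hv1 : ‖v‖ = 1 := by simpa using hv
  have h := range_stereographic_symm hv1
  rw [← image_sphereParam hr, ← Set.image_singleton, ← Set.image_sdiff (injective_sphereParam hr p)]
  have hc : Continuous (stereographic hv1).symm := by
    exact (isOpenEmbedding_stereographic_symm hv1).continuous
  have e : Metric.sphere (0 : EuclideanSpace ℝ (Fin 3)) 1 \ {v} =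
      Subtype.val '' Set.range (stereographic hv1).symm := by
    rw [h]
    ext x
    simp
  rw [e]
  exact ((isPreconnected_range hc).image _ continuous_subtype_val.continuousOn).image _
    (continuous_sphereParam r p).continuousOn

lemma nonempty_sphereEq {r : ℝ} (p : Fin 3 → ℝ) : sphereEq r p ![p 0 + r, p 1, p 2] = 0 := by
  simp [sphereEq]

lemma continuous_hypEq (a c : ℝ) : Continuous (hypEq a c) := by
  unfold hypEq; fun_prop

/-- If a continuous function changes sign on the sphere, it has two zeros there. -/
lemma exists_two_zeros {r : ℝ} (hr : 0 < r) {p : Fin 3 → ℝ} {F : (Fin 3 → ℝ) → ℝ}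
    (hF : Continuous F) {q₁ q₂ : Fin 3 → ℝ} (h₁ : sphereEq r p q₁ = 0) (h₂ : sphereEq r p q₂ = 0)
    (hn : F q₁ < 0) (hp : 0 < F q₂) :
    ∃ x y, x ≠ y ∧ sphereEq r p x = 0 ∧ sphereEq r p y = 0 ∧ F x = 0 ∧ F y = 0 := by
  obtain ⟨x, hx, hx0⟩ := (isPreconnected_sphereEq hr p).intermediate_value h₁ h₂ hF.continuousOn
    (Set.mem_Icc.2 ⟨hn.le, hp.le⟩)
  -- Removing the first zero leaves a connected set that still contains both signs.
  obtain ⟨y, hy, hy0⟩ := (isPreconnected_sphereEq_diff hr p x hx).intermediate_value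
    (a := q₁) (b := q₂) ⟨h₁, fun h => by rw [Set.mem_singleton_iff.1 h, hx0] at hn; exact hn.false⟩
    ⟨h₂, fun h => by rw [Set.mem_singleton_iff.1 h, hx0] at hp; exact hp.false⟩ hF.continuousOn
    (Set.mem_Icc.2 ⟨hn.le, hp.le⟩)
  exact ⟨x, y, fun h => hy.2 h.symm, hx, hy.1, hx0, hy0⟩

/-! ### Lagrange multipliers with a global second-order condition -/

lemma eq_zero_of_forall_mul_nonneg {P : ℝ → ℝ} (hP : Continuous P) (h : ∀ ε, 0 ≤ ε * P ε) :
    P 0 = 0 := by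
  have h1 : 0 ≤ P 0 := by
    by_contra! hneg
    have := (hP.tendsto 0).eventually (gt_mem_nhds hneg)
    obtain ⟨δ, hδ, hb⟩ := Metric.eventually_nhds_iff.1 this
    have h1 := hb (y := δ / 2) (by rw [Real.dist_eq, sub_zero, abs_of_pos (by linarith)]; linarith)
    have := h (δ / 2)
    nlinarith
  have h2 : P 0 ≤ 0 := by
    by_contra! hpos
    have := (hP.tendsto 0).eventually (lt_mem_nhds hpos)
    obtain ⟨δ, hδ, hb⟩ := Metric.eventually_nhds_iff.1 this
    have h1 := hb (y := -(δ / 2)) (by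
      rw [Real.dist_eq, sub_zero, abs_neg, abs_of_pos (by linarith)]; linarith)
    have := h (-(δ / 2))
    nlinarith
  exact le_antisymm h2 h1

lemma nonneg_of_forall_add_sq_mul {x y : ℝ} (h : ∀ ε ≠ 0, 0 ≤ x + ε ^ 2 * y) : 0 ≤ x := by
  have ht : Filter.Tendsto (fun ε : ℝ => x + ε ^ 2 * y) (nhdsWithin 0 {0}ᶜ) (nhds x) := by
    have : Continuous fun ε : ℝ => x + ε ^ 2 * y := by fun_prop
    simpa using (this.tendsto 0).mono_left nhdsWithin_le_nhds
  refine ge_of_tendsto ht ?_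
  filter_upwards [self_mem_nhdsWithin] with ε hε using h ε hε

lemma eq_zero_of_sum_sq_eq_zero {x y z : ℝ} (h : x ^ 2 + y ^ 2 + z ^ 2 = 0) :
    x = 0 ∧ y = 0 ∧ z = 0 := by
  refine ⟨?_, ?_, ?_⟩ <;> nlinarith [sq_nonneg x, sq_nonneg y, sq_nonneg z]

/-- The vectorial content of the Lagrange multiplier rule for a diagonal quadratic function
on a sphere: `u` is the radius vector of a minimizer, `n` half the gradient there, and the
hypothesis compares the value at `u` with that at the reflection of `u` along `v`. -/
lemma exists_multiplier {e₁ e₂ u₀ u₁ u₂ n₀ n₁ n₂ r : ℝ} (hr : 0 < r)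
    (hu : u₀ ^ 2 + u₁ ^ 2 + u₂ ^ 2 = r ^ 2)
    (h : ∀ v₀ v₁ v₂ : ℝ, 0 ≤ (v₀ * u₀ + v₁ * u₁ + v₂ * u₂) *
      ((v₀ * u₀ + v₁ * u₁ + v₂ * u₂) * (e₁ * (v₀ ^ 2 + v₁ ^ 2) + e₂ * v₂ ^ 2) -
        (v₀ * n₀ + v₁ * n₁ + v₂ * n₂) * (v₀ ^ 2 + v₁ ^ 2 + v₂ ^ 2))) :
    ∃ μ : ℝ, 0 ≤ e₁ + μ ∧ 0 ≤ e₂ + μ ∧ n₀ + μ * u₀ = 0 ∧ n₁ + μ * u₁ = 0 ∧ n₂ + μ * u₂ = 0 := by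
  -- This `μ` makes `n + μu` orthogonal to `u`; it remains to see that this tangential part `t`
  -- vanishes.
  obtain ⟨μ, hμ⟩ : ∃ μ, μ * r ^ 2 = -(n₀ * u₀ + n₁ * u₁ + n₂ * u₂) :=
    ⟨-(n₀ * u₀ + n₁ * u₁ + n₂ * u₂) / r ^ 2, by field_simp⟩
  have hr2 : 0 < r ^ 2 := by positivity
  obtain ⟨t₀, ht₀⟩ : ∃ t, t = n₀ + μ * u₀ := ⟨_, rfl⟩
  obtain ⟨t₁, ht₁⟩ : ∃ t, t = n₁ + μ * u₁ := ⟨_, rfl⟩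
  obtain ⟨t₂, ht₂⟩ : ∃ t, t = n₂ + μ * u₂ := ⟨_, rfl⟩
  have htu : t₀ * u₀ + t₁ * u₁ + t₂ * u₂ = 0 := by
    rw [ht₀, ht₁, ht₂]; linear_combination μ * hu + hμ
  have htn : t₀ * n₀ + t₁ * n₁ + t₂ * n₂ = t₀ ^ 2 + t₁ ^ 2 + t₂ ^ 2 := by
    linear_combination -t₀ * ht₀ - t₁ * ht₁ - t₂ * ht₂ - μ * htu
  -- Reflecting along `t + εu` turns the hypothesis into `0 ≤ ε P(ε)`, and `P(0) = -r²|t|⁴`.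
  have hzero : t₀ ^ 2 + t₁ ^ 2 + t₂ ^ 2 = 0 := by
    have key := eq_zero_of_forall_mul_nonneg (P := fun ε => r ^ 2 *
      (ε * r ^ 2 * (e₁ * ((t₀ + ε * u₀) ^ 2 + (t₁ + ε * u₁) ^ 2) + e₂ * (t₂ + ε * u₂) ^ 2) -
        ((t₀ + ε * u₀) * n₀ + (t₁ + ε * u₁) * n₁ + (t₂ + ε * u₂) * n₂) *
          ((t₀ + ε * u₀) ^ 2 + (t₁ + ε * u₁) ^ 2 + (t₂ + ε * u₂) ^ 2))) (by fun_prop) (by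
      intro ε
      have hε := h (t₀ + ε * u₀) (t₁ + ε * u₁) (t₂ + ε * u₂)
      have e : (t₀ + ε * u₀) * u₀ + (t₁ + ε * u₁) * u₁ + (t₂ + ε * u₂) * u₂ = ε * r ^ 2 := by
        linear_combination htu + ε * hu
      rw [e] at hε
      linarith)
    simp only [zero_mul, add_zero, zero_sub, htn] at key
    have : r ^ 2 * (t₀ ^ 2 + t₁ ^ 2 + t₂ ^ 2) ^ 2 = 0 := by linear_combination -key
    rcases mul_eq_zero.1 this with h | h
    · exact absurd h hr2.ne'
    · exact pow_eq_zero_iff two_ne_zero |>.1 h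
  obtain ⟨hz₀, hz₁, hz₂⟩ := eq_zero_of_sum_sq_eq_zero hzero
  rw [hz₀] at ht₀; rw [hz₁] at ht₁; rw [hz₂] at ht₂
  have hpos : ∀ v₀ v₁ v₂ : ℝ, v₀ * u₀ + v₁ * u₁ + v₂ * u₂ ≠ 0 →
      0 ≤ (e₁ + μ) * (v₀ ^ 2 + v₁ ^ 2) + (e₂ + μ) * v₂ ^ 2 := by
    intro v₀ v₁ v₂ hv
    have h1 := h v₀ v₁ v₂
    have h2 : v₀ * n₀ + v₁ * n₁ + v₂ * n₂ = -μ * (v₀ * u₀ + v₁ * u₁ + v₂ * u₂) := by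
      linear_combination -v₀ * ht₀ - v₁ * ht₁ - v₂ * ht₂
    rw [h2] at h1
    have h3 : 0 < (v₀ * u₀ + v₁ * u₁ + v₂ * u₂) ^ 2 := by positivity
    refine nonneg_of_mul_nonneg_right (a := (v₀ * u₀ + v₁ * u₁ + v₂ * u₂) ^ 2) ?_ h3
    linarith
  refine ⟨μ, ?_, ?_, ht₀.symm, ht₁.symm, ht₂.symm⟩
  -- A coordinate direction orthogonal to `u` gives no information, so it is tilted by `εu` and `ε`
  -- tends to zero.
  · by_cases h0 : u₀ = 0
    · refine nonneg_of_forall_add_sq_mul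
        (y := (e₁ + μ) * (u₀ ^ 2 + u₁ ^ 2) + (e₂ + μ) * u₂ ^ 2) fun ε hε => ?_
      have := hpos (1 + ε * u₀) (ε * u₁) (ε * u₂) (by
        have : (1 + ε * u₀) * u₀ + ε * u₁ * u₁ + ε * u₂ * u₂ = ε * r ^ 2 := by
          rw [h0] at hu ⊢; linear_combination ε * hu
        rw [this]; positivity)
      rw [h0] at this ⊢
      linarith
    · simpa using hpos 1 0 0 (by simpa using h0)
  · by_cases h0 : u₂ = 0
    · refine nonneg_of_forall_add_sq_mul
        (y := (e₁ + μ) * (u₀ ^ 2 + u₁ ^ 2) + (e₂ + μ) * u₂ ^ 2) fun ε hε => ?_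
      have := hpos (ε * u₀) (ε * u₁) (1 + ε * u₂) (by
        have : ε * u₀ * u₀ + ε * u₁ * u₁ + (1 + ε * u₂) * u₂ = ε * r ^ 2 := by
          rw [h0] at hu ⊢; linear_combination ε * hu
        rw [this]; positivity)
      rw [h0] at this ⊢
      linarith
    · simpa using hpos 0 0 1 (by simpa using h0)

/-- Lagrange multiplier rule, with the global second order condition, for the minimum of a diagonal
quadratic function on a sphere. -/
lemma exists_minimizer_multiplier {r : ℝ} (hr : 0 < r) (p : Fin 3 → ℝ) (e₁ e₂ e₃ : ℝ) :
    ∃ (q : Fin 3 → ℝ) (μ : ℝ), sphereEq r p q = 0 ∧ 0 ≤ e₁ + μ ∧ 0 ≤ e₂ + μ ∧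
      e₁ * q 0 + μ * (q 0 - p 0) = 0 ∧ e₁ * q 1 + μ * (q 1 - p 1) = 0 ∧
      e₂ * q 2 + μ * (q 2 - p 2) = 0 ∧
      ∀ x, sphereEq r p x = 0 → e₁ * (q 0 ^ 2 + q 1 ^ 2) + e₂ * q 2 ^ 2 + e₃ ≤
        e₁ * (x 0 ^ 2 + x 1 ^ 2) + e₂ * x 2 ^ 2 + e₃ := by
  obtain ⟨q, hq, hmin⟩ := (isCompact_sphereEq hr p).exists_isMinOn ⟨_, nonempty_sphereEq p⟩
    (f := fun x => e₁ * (x 0 ^ 2 + x 1 ^ 2) + e₂ * x 2 ^ 2 + e₃) (by fun_prop)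
  have hmin' : ∀ x, sphereEq r p x = 0 → e₁ * (q 0 ^ 2 + q 1 ^ 2) + e₂ * q 2 ^ 2 + e₃ ≤
        e₁ * (x 0 ^ 2 + x 1 ^ 2) + e₂ * x 2 ^ 2 + e₃ := fun x hx => hmin hx
  simp only [Set.mem_ofPred_eq, sphereEq] at hq
  obtain ⟨μ, h1, h2, h3, h4, h5⟩ := exists_multiplier (e₁ := e₁) (e₂ := e₂) (u₀ := q 0 - p 0)
    (u₁ := q 1 - p 1) (u₂ := q 2 - p 2) (n₀ := e₁ * q 0) (n₁ := e₁ * q 1) (n₂ := e₂ * q 2) hr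
    (by linear_combination hq) (by
      intro v₀ v₁ v₂
      rcases (by positivity : 0 ≤ v₀ ^ 2 + v₁ ^ 2 + v₂ ^ 2).eq_or_lt with h0 | h0
      · obtain ⟨e0, e1, e2⟩ := eq_zero_of_sum_sq_eq_zero h0.symm
        simp [e0, e1, e2]
      obtain ⟨N, hN⟩ : ∃ N, N = v₀ ^ 2 + v₁ ^ 2 + v₂ ^ 2 := ⟨_, rfl⟩
      obtain ⟨D, hD⟩ : ∃ D, D = v₀ * (q 0 - p 0) + v₁ * (q 1 - p 1) + v₂ * (q 2 - p 2) := ⟨_, rfl⟩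
      rw [← hN] at h0 ⊢
      rw [← hD]
      -- With this `k`, the point `q - kv` is the mirror image of `q` in the plane through the
      -- centre orthogonal to `v`, hence lies on the sphere.
      obtain ⟨k, hk⟩ : ∃ k, k * N = 2 * D := ⟨2 * D / N, by field_simp⟩
      have := hmin' ![q 0 - k * v₀, q 1 - k * v₁, q 2 - k * v₂] (by
        simp [sphereEq]
        linear_combination hq + 2 * k * hD - k ^ 2 * hN + k * hk)
      simp at this
      have h6 : 0 ≤ k * (k * (e₁ * (v₀ ^ 2 + v₁ ^ 2) + e₂ * v₂ ^ 2) -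
        2 * (v₀ * (e₁ * q 0) + v₁ * (e₁ * q 1) + v₂ * (e₂ * q 2))) := by linarith
      have h7 := mul_nonneg h6 (sq_nonneg N)
      have h8 : k * (k * (e₁ * (v₀ ^ 2 + v₁ ^ 2) + e₂ * v₂ ^ 2) -
        2 * (v₀ * (e₁ * q 0) + v₁ * (e₁ * q 1) + v₂ * (e₂ * q 2))) * N ^ 2 =
        (k * N) * ((k * N) * (e₁ * (v₀ ^ 2 + v₁ ^ 2) + e₂ * v₂ ^ 2) -
        2 * (v₀ * (e₁ * q 0) + v₁ * (e₁ * q 1) + v₂ * (e₂ * q 2)) * N) := by ring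
      rw [h8, hk] at h7
      linarith)
  exact ⟨q, μ, hq, h1, h2, h3, h4, h5, hmin'⟩

/-! ### The pencil and the signs of the cubic -/

/-- The quadratic function of the pencil spanned by the two surfaces. -/
def pencilEq (a c r : ℝ) (p : Fin 3 → ℝ) (t : ℝ) (q : Fin 3 → ℝ) : ℝ :=
  a ^ 2 * c ^ 2 * sphereEq r p q + t * hypEq a c q

/-- Completion of squares in the pencil. -/
lemma mul_pencilEq (a c r : ℝ) (p : Fin 3 → ℝ) (t : ℝ) (q : Fin 3 → ℝ) :
    (t + a ^ 2) * (c ^ 2 - t) * pencilEq a c r p t q =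
      (c ^ 2 - t) * c ^ 2 * (((t + a ^ 2) * q 0 - a ^ 2 * p 0) ^ 2 +
        ((t + a ^ 2) * q 1 - a ^ 2 * p 1) ^ 2) +
      (t + a ^ 2) * a ^ 2 * ((c ^ 2 - t) * q 2 - c ^ 2 * p 2) ^ 2 +
      a ^ 2 * c ^ 2 * reducedCubic a c r p t := by
  unfold pencilEq sphereEq hypEq reducedCubic; ring

/-- The point where the member `t` of the pencil has its critical point. -/
noncomputable def pencilVertex (a c : ℝ) (p : Fin 3 → ℝ) (t : ℝ) : Fin 3 → ℝ :=
  ![a ^ 2 * p 0 / (t + a ^ 2), a ^ 2 * p 1 / (t + a ^ 2), c ^ 2 * p 2 / (c ^ 2 - t)]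

/-- The completed squares vanish at the vertex, so only the constant survives. At a root of the
cubic the member is a cone with this apex. -/
lemma pencilEq_pencilVertex {a c r t : ℝ} (p : Fin 3 → ℝ) (h1 : t + a ^ 2 ≠ 0)
    (h2 : c ^ 2 - t ≠ 0) :
    (t + a ^ 2) * (c ^ 2 - t) * pencilEq a c r p t (pencilVertex a c p t) =
      a ^ 2 * c ^ 2 * reducedCubic a c r p t := by
  rw [mul_pencilEq]
  simp [pencilVertex]
  field_simp
  ring

lemma reducedCubic_zero_neg {a c r : ℝ} (ha : 0 < a) (hc : 0 < c) (hr : 0 < r) (p : Fin 3 → ℝ) :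
    reducedCubic a c r p 0 < 0 := by
  have : 0 < a ^ 2 * c ^ 2 * r ^ 2 := by positivity
  unfold reducedCubic
  linarith

lemma reducedCubic_neg_sq (a c r : ℝ) (p : Fin 3 → ℝ) :
    reducedCubic a c r p (-a ^ 2) = -(p 0 ^ 2 + p 1 ^ 2) * (a ^ 2 * (a ^ 2 + c ^ 2)) := by
  unfold reducedCubic
  ring

lemma reducedCubic_sq (a c r : ℝ) (p : Fin 3 → ℝ) :
    reducedCubic a c r p (c ^ 2) = -p 2 ^ 2 * (c ^ 2 * (a ^ 2 + c ^ 2)) := by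
  unfold reducedCubic
  ring

lemma reducedCubic_neg_sq_nonpos (a c r : ℝ) (p : Fin 3 → ℝ) :
    reducedCubic a c r p (-a ^ 2) ≤ 0 := by
  rw [reducedCubic_neg_sq]
  have : 0 ≤ (p 0 ^ 2 + p 1 ^ 2) * (a ^ 2 * (a ^ 2 + c ^ 2)) := by positivity
  linarith

lemma reducedCubic_sq_nonpos (a c r : ℝ) (p : Fin 3 → ℝ) :
    reducedCubic a c r p (c ^ 2) ≤ 0 := by
  rw [reducedCubic_sq]
  have : 0 ≤ p 2 ^ 2 * (c ^ 2 * (a ^ 2 + c ^ 2)) := by positivity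
  linarith

lemma hypEq_eq_iff {a c : ℝ} (hc : 0 < c) (q : Fin 3 → ℝ) :
    hypEq a c q = 0 ↔ (q 0 ^ 2 + q 1 ^ 2) = a ^ 2 * (1 + q 2 ^ 2 / c ^ 2) := by
  unfold hypEq
  constructor
  · intro h
    field_simp
    linarith
  · intro h
    field_simp at h
    linarith

/-! ### Tangency and double roots -/

/-- `q` is a common point at which the two gradients are proportional. -/
def TangentWith (a c r : ℝ) (p : Fin 3 → ℝ) (t : ℝ) (q : Fin 3 → ℝ) : Prop :=
  hypEq a c q = 0 ∧ sphereEq r p q = 0 ∧ (t + a ^ 2) * q 0 = a ^ 2 * p 0 ∧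
    (t + a ^ 2) * q 1 = a ^ 2 * p 1 ∧ (c ^ 2 - t) * q 2 = c ^ 2 * p 2

/-- The gradient equations turn every square in `mul_pencilEq` at `q` into `(x - t)²` times the
square of a coordinate, while all members of the pencil vanish at `q`. The remaining linear factor
is evaluated with the hyperboloid equation. -/
lemma TangentWith.reducedCubic_eq {a c r : ℝ} (ha : 0 < a) (hc : 0 < c) {p : Fin 3 → ℝ} {t : ℝ}
    {q : Fin 3 → ℝ} (h : TangentWith a c r p t q) (x : ℝ) :
    reducedCubic a c r p x =
      (x - t) * (x - t) * (x - (c ^ 2 + q 2 ^ 2 * (1 + a ^ 2 / c ^ 2))) := by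
  obtain ⟨h1, h2, h3, h4, h5⟩ := h
  have key := mul_pencilEq a c r p x q
  have e0 : (x + a ^ 2) * q 0 - a ^ 2 * p 0 = (x - t) * q 0 := by linear_combination h3
  have e1 : (x + a ^ 2) * q 1 - a ^ 2 * p 1 = (x - t) * q 1 := by linear_combination h4
  have e2 : (c ^ 2 - x) * q 2 - c ^ 2 * p 2 = (t - x) * q 2 := by linear_combination h5
  rw [e0, e1, e2, pencilEq, h1, h2] at key
  have key2 : a ^ 2 * c ^ 2 * reducedCubic a c r p x = a ^ 2 * c ^ 2 *
      ((x - t) * (x - t) * (x - (c ^ 2 + q 2 ^ 2 * (1 + a ^ 2 / c ^ 2)))) := by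
    have e3 : a ^ 2 * c ^ 2 * ((x - t) * (x - t) * (x - (c ^ 2 + q 2 ^ 2 * (1 + a ^ 2 / c ^ 2)))) =
        a ^ 2 * (x - t) ^ 2 * (c ^ 2 * x - c ^ 4 - q 2 ^ 2 * (c ^ 2 + a ^ 2)) := by
      field_simp
      ring
    rw [e3]
    simp only [hypEq] at h1
    linear_combination -key - (c ^ 2 - x) * (x - t) ^ 2 * h1
  have hne : a ^ 2 * c ^ 2 ≠ 0 := by positivity
  exact mul_left_cancel₀ hne key2

lemma TangentWith.ne_zero {a c r : ℝ} (ha : 0 < a) (hc : 0 < c) (hr : 0 < r) {p : Fin 3 → ℝ}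
    {t : ℝ} {q : Fin 3 → ℝ} (h : TangentWith a c r p t q) : t ≠ 0 := by
  rintro rfl
  have := reducedCubic_zero_neg ha hc hr p
  rw [h.reducedCubic_eq ha hc] at this
  simp at this

lemma tangentAt_iff {a c r : ℝ} (ha : 0 < a) (hc : 0 < c) (hr : 0 < r) {p q : Fin 3 → ℝ} :
    TangentAt (hyperboloidMatrix a c) (sphereMatrix p r) q ↔ ∃ t, TangentWith a c r p t q := by
  have hH : ∀ Y : Fin 4 → ℝ, Y ⬝ᵥ (hyperboloidMatrix a c *ᵥ homCoord q) =
      Y 0 * (q 0 / a ^ 2) + Y 1 * (q 1 / a ^ 2) - Y 2 * (q 2 / c ^ 2) - Y 3 := by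
    intro Y
    simp [hyperboloidMatrix, homCoord, dotProduct, Matrix.mulVec, Fin.sum_univ_four]
    ring
  have hS : ∀ Y : Fin 4 → ℝ, Y ⬝ᵥ (sphereMatrix p r *ᵥ homCoord q) =
      Y 0 * (q 0 - p 0) + Y 1 * (q 1 - p 1) + Y 2 * (q 2 - p 2) +
        Y 3 * (p 0 ^ 2 + p 1 ^ 2 + p 2 ^ 2 - r ^ 2 - p 0 * q 0 - p 1 * q 1 - p 2 * q 2) := by
    intro Y
    simp [sphereMatrix, homCoord, dotProduct, Matrix.mulVec, Fin.sum_univ_four]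
    ring
  rw [TangentAt, quadValue_hyperboloidMatrix_eq_zero ha hc, quadValue_sphereMatrix]
  simp only [hH, hS]
  -- The last coefficient of the tangent plane is `-1` for the hyperboloid and `m` for the sphere,
  -- so the ratio of the planes is `-m` and `m` is the pencil parameter.
  obtain ⟨m, hm⟩ : ∃ m, m = p 0 ^ 2 + p 1 ^ 2 + p 2 ^ 2 - r ^ 2 - p 0 * q 0 - p 1 * q 1
    - p 2 * q 2 := ⟨_, rfl⟩
  rw [← hm]
  constructor
  · rintro ⟨⟨h1, h2⟩, h⟩
    refine ⟨m, h1, h2, ?_, ?_, ?_⟩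
    -- The test vectors are chosen in the kernel of the hyperboloid's tangent form, one for each
    -- coordinate.
    · have := (h ![1, 0, 0, q 0 / a ^ 2]).1 (by simp)
      simp at this
      field_simp at this
      linear_combination this
    · have := (h ![0, 1, 0, q 1 / a ^ 2]).1 (by simp)
      simp at this
      field_simp at this
      linear_combination this
    · have := (h ![0, 0, 1, -(q 2 / c ^ 2)]).1 (by simp)
      simp at this
      field_simp at this
      linear_combination this
  · rintro ⟨t, ht⟩
    have ht0 := ht.ne_zero ha hc hr
    obtain ⟨h1, h2, h3, h4, h5⟩ := ht
    refine ⟨⟨h1, h2⟩, fun Y => ?_⟩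
    have e0 : q 0 - p 0 = -t * (q 0 / a ^ 2) := by field_simp; linear_combination h3
    have e1 : q 1 - p 1 = -t * (q 1 / a ^ 2) := by field_simp; linear_combination h4
    have e2 : q 2 - p 2 = t * (q 2 / c ^ 2) := by field_simp; linear_combination h5
    have e3 : m = t := by
      simp only [sphereEq] at h2
      have hh : q 0 * (q 0 / a ^ 2) + q 1 * (q 1 / a ^ 2) - q 2 * (q 2 / c ^ 2) = 1 := by
        have := (hypEq_eq_iff hc q).1 h1
        field_simp at this ⊢
        linear_combination this
      rw [hm]
      linear_combination h2 - q 0 * e0 - q 1 * e1 - q 2 * e2 + t * hh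
    rw [e0, e1, e2, e3]
    have : Y 0 * (-t * (q 0 / a ^ 2)) + Y 1 * (-t * (q 1 / a ^ 2)) + Y 2 * (t * (q 2 / c ^ 2)) +
        Y 3 * t = -t * (Y 0 * (q 0 / a ^ 2) + Y 1 * (q 1 / a ^ 2) - Y 2 * (q 2 / c ^ 2) - Y 3) := by
      ring
    rw [this, mul_eq_zero]
    simp [ht0]

lemma areTangent_iff {a c r : ℝ} (ha : 0 < a) (hc : 0 < c) (hr : 0 < r) {p : Fin 3 → ℝ} :
    AreTangent (hyperboloidMatrix a c) (sphereMatrix p r) ↔ ∃ q t, TangentWith a c r p t q := by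
  simp only [AreTangent, tangentAt_iff ha hc hr]

/-- At a root, the derivative of the cubic is a multiple of the value of the hyperboloid equation at
the pencil vertex. -/
lemma hypEq_pencilVertex {a c r : ℝ} {p : Fin 3 → ℝ} {t l m : ℝ}
    (h : ∀ x, reducedCubic a c r p x = (x - t) * (x - l) * (x - m)) (h1 : t + a ^ 2 ≠ 0)
    (h2 : c ^ 2 - t ≠ 0) :
    (t + a ^ 2) * (c ^ 2 - t) * hypEq a c (pencilVertex a c p t) =
      a ^ 2 * c ^ 2 * ((t - l) * (t - m)) := by
  have ht := h t
  -- This equates the derivatives at `t`; the finite-difference combination of the values at `t`, `t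
  -- ± 1`, `t + 2` is exact for cubics.
  have hd : (t - c ^ 2) * (t + r ^ 2) + (t + a ^ 2) * (t + r ^ 2) + (t + a ^ 2) * (t - c ^ 2)
      - (p 0 ^ 2 + p 1 ^ 2) * (2 * t - c ^ 2) - p 2 ^ 2 * (2 * t + a ^ 2) =
      (t - l) * (t - m) := by
    have e1 := h (t + 1)
    have e2 := h (t - 1)
    have e3 := h (t + 2)
    unfold reducedCubic at ht e1 e2 e3
    linear_combination e1 - 1/2 * ht - 1/3 * e2 - 1/6 * e3
  simp only [sub_self, zero_mul] at ht
  unfold reducedCubic at ht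
  have : (t + a ^ 2) ^ 2 * (c ^ 2 - t) ^ 2 * hypEq a c (pencilVertex a c p t) =
      a ^ 2 * c ^ 2 * (a ^ 2 * (p 0 ^ 2 + p 1 ^ 2) * (c ^ 2 - t) ^ 2 -
        c ^ 2 * p 2 ^ 2 * (t + a ^ 2) ^ 2 - (t + a ^ 2) ^ 2 * (c ^ 2 - t) ^ 2) := by
    simp [hypEq, pencilVertex]
    field_simp
  refine mul_left_cancel₀ (mul_ne_zero h1 h2) ?_
  linear_combination this + a ^ 2 * c ^ 2 * (t + a ^ 2) * (c ^ 2 - t) * hd -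
    a ^ 2 * c ^ 2 * (c ^ 2 - 2 * t - a ^ 2) * ht

/-- A double root of the cubic gives a tangency at the critical point of that pencil member. -/
lemma tangentWith_pencilVertex {a c r : ℝ} (ha : 0 < a) (hc : 0 < c) {p : Fin 3 → ℝ} {t l : ℝ}
    (h : ∀ x, reducedCubic a c r p x = (x - t) * (x - t) * (x - l)) (h1 : t + a ^ 2 ≠ 0)
    (h2 : c ^ 2 - t ≠ 0) : TangentWith a c r p t (pencilVertex a c p t) := by
  have hη : hypEq a c (pencilVertex a c p t) = 0 := by
    simpa [h1, h2] using hypEq_pencilVertex h h1 h2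
  have hL := pencilEq_pencilVertex (r := r) p h1 h2
  rw [h t, sub_self, zero_mul, zero_mul, mul_zero, pencilEq, hη, mul_zero, add_zero] at hL
  refine ⟨hη, by simpa [h1, h2, ha.ne', hc.ne'] using hL, ?_, ?_, ?_⟩ <;>
    simp [pencilVertex] <;> field_simp

/-! ### Spheres on one side of the hyperboloid -/

/-- Sum over an antipodal pair of points of the sphere. -/
lemma hypEq_antipodal_horizontal (a c r : ℝ) (p : Fin 3 → ℝ) :
    hypEq a c ![p 0 + r, p 1, p 2] + hypEq a c ![p 0 - r, p 1, p 2] =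
      2 * hypEq a c p + 2 * (c ^ 2 * r ^ 2) := by
  simp [hypEq]; ring

lemma hypEq_antipodal_vertical (a c r : ℝ) (p : Fin 3 → ℝ) :
    hypEq a c ![p 0, p 1, p 2 + r] + hypEq a c ![p 0, p 1, p 2 - r] =
      2 * hypEq a c p - 2 * (a ^ 2 * r ^ 2) := by
  simp [hypEq]; ring

/-- `hypEq` is strictly convex along horizontal lines, so its value at the centre is below the mean
over a horizontal antipodal pair. The opposite sign uses strict concavity along the vertical. -/
lemma hypEq_center_neg {a c r : ℝ} (hc : 0 < c) (hr : 0 < r) {p : Fin 3 → ℝ}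
    (h : ∀ q, sphereEq r p q = 0 → hypEq a c q ≤ 0) : hypEq a c p < 0 := by
  have h1 := h ![p 0 + r, p 1, p 2] (by simp [sphereEq])
  have h2 := h ![p 0 - r, p 1, p 2] (by simp [sphereEq])
  have := hypEq_antipodal_horizontal a c r p
  have : 0 < c ^ 2 * r ^ 2 := by positivity
  linarith

lemma hypEq_center_pos {a c r : ℝ} (ha : 0 < a) (hr : 0 < r) {p : Fin 3 → ℝ}
    (h : ∀ q, sphereEq r p q = 0 → 0 ≤ hypEq a c q) : 0 < hypEq a c p := by
  have h1 := h ![p 0, p 1, p 2 + r] (by simp [sphereEq])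
  have h2 := h ![p 0, p 1, p 2 - r] (by simp [sphereEq])
  have := hypEq_antipodal_vertical a c r p
  have : 0 < a ^ 2 * r ^ 2 := by positivity
  linarith

lemma pencilEq_pos {a c r : ℝ} (ha : 0 < a) (hc : 0 < c) {p : Fin 3 → ℝ} {t : ℝ}
    (h1 : 0 < t + a ^ 2) (h2 : 0 < c ^ 2 - t) (h : 0 < reducedCubic a c r p t) (q : Fin 3 → ℝ) :
    0 < pencilEq a c r p t q := by
  have := mul_pencilEq a c r p t q
  have h3 : 0 < (t + a ^ 2) * (c ^ 2 - t) * pencilEq a c r p t q := by rw [this]; positivity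
  exact pos_of_mul_pos_right h3 (by positivity)

/-- All points of the sphere are interior iff some member of the pencil with parameter in
`(-a², 0)` is positive definite. -/
lemma forall_hypEq_neg_iff {a c r : ℝ} (ha : 0 < a) (hc : 0 < c) (hr : 0 < r) {p : Fin 3 → ℝ} :
    (∀ q, sphereEq r p q = 0 → hypEq a c q < 0) ↔
      ∃ t, -a ^ 2 < t ∧ t < 0 ∧ 0 < reducedCubic a c r p t := by
  constructor
  · intro h
    -- The function minimized is `-hypEq`, so the second-order condition reads `μ ≥ c²`.
    obtain ⟨q, μ, hq, h1, h2, h3, h4, h5, -⟩ :=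
      exists_minimizer_multiplier hr p (-c ^ 2) (a ^ 2) (a ^ 2 * c ^ 2)
    have hδ := h q hq
    -- Adding `ε` to `μ` moves the parameter strictly above `-a²`. The loss is at most `εr²`, as
    -- `sphereEq ≥ -r²` everywhere, and this is less than the minimum of `-hypEq`.
    obtain ⟨ε, hε, hεδ⟩ : ∃ ε, 0 < ε ∧ ε * r ^ 2 < -hypEq a c q := by
      refine ⟨-hypEq a c q / (2 * r ^ 2), div_pos (by linarith) (by positivity), ?_⟩
      field_simp
      linarith
    have hμ : 0 < μ := by nlinarith
    have hm : 0 < μ + ε := by linarith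
    have ht : -a ^ 2 < -(a ^ 2 * c ^ 2) / (μ + ε) := by
      rw [lt_div_iff₀ hm]
      nlinarith [mul_pos (pow_pos ha 2) hε, mul_nonneg (pow_pos ha 2).le h1]
    have ht0 : -(a ^ 2 * c ^ 2) / (μ + ε) < 0 := div_neg_of_neg_of_pos
      (neg_lt_zero.2 (by positivity)) hm
    refine ⟨_, ht, ht0, ?_⟩
    generalize htt : -(a ^ 2 * c ^ 2) / (μ + ε) = t at ht ht0
    have hc2 : 0 < c ^ 2 := by positivity
    have hv := pencilEq_pencilVertex (r := r) p (t := t) (a := a) (c := c) (by linarith)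
      (by linarith)
    have hpos : ∀ x, 0 < pencilEq a c r p t x := by
      intro x
      have e : (μ + ε) * t = -(a ^ 2 * c ^ 2) := by rw [← htt]; field_simp
      -- Expansion about `q`: the multiplier equations kill the linear terms, and the second-order
      -- condition makes the quadratic ones nonnegative.
      have key : (μ + ε) * sphereEq r p x - hypEq a c x = -hypEq a c q + ε * sphereEq r p x +
          (-c ^ 2 + μ) * ((x 0 - q 0) ^ 2 + (x 1 - q 1) ^ 2) + (a ^ 2 + μ) * (x 2 - q 2) ^ 2 := by
        simp only [sphereEq, hypEq] at hq ⊢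
        linear_combination μ * hq + 2 * (x 0 - q 0) * h3 + 2 * (x 1 - q 1) * h4
          + 2 * (x 2 - q 2) * h5
      have hs : -r ^ 2 ≤ sphereEq r p x := by
        unfold sphereEq
        linarith [sq_nonneg (x 0 - p 0), sq_nonneg (x 1 - p 1), sq_nonneg (x 2 - p 2)]
      have h6 : 0 < (μ + ε) * sphereEq r p x - hypEq a c x := by
        rw [key]
        have : 0 ≤ (-c ^ 2 + μ) * ((x 0 - q 0) ^ 2 + (x 1 - q 1) ^ 2) := by positivity
        have : 0 ≤ (a ^ 2 + μ) * (x 2 - q 2) ^ 2 := by positivity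
        nlinarith
      have h7 : (μ + ε) * pencilEq a c r p t x =
          a ^ 2 * c ^ 2 * ((μ + ε) * sphereEq r p x - hypEq a c x) := by
        unfold pencilEq; linear_combination hypEq a c x * e
      exact pos_of_mul_pos_right (a := μ + ε) (by rw [h7]; positivity) hm.le
    have h8 : 0 < a ^ 2 * c ^ 2 * reducedCubic a c r p t := by
      rw [← hv]
      exact mul_pos (mul_pos (by linarith) (by linarith)) (hpos _)
    exact pos_of_mul_pos_right h8 (by positivity)
  · rintro ⟨t, h1, h2, h3⟩ q hq
    have := pencilEq_pos ha hc (by linarith) (by nlinarith) h3 q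
    rw [pencilEq, hq, mul_zero, zero_add] at this
    nlinarith

/-- All points of the sphere are exterior iff some member of the pencil with parameter in
`(0, c²)` is positive definite. -/
lemma forall_hypEq_pos_iff {a c r : ℝ} (ha : 0 < a) (hc : 0 < c) (hr : 0 < r) {p : Fin 3 → ℝ} :
    (∀ q, sphereEq r p q = 0 → 0 < hypEq a c q) ↔
      ∃ t, 0 < t ∧ t < c ^ 2 ∧ 0 < reducedCubic a c r p t := by
  constructor
  · intro h
    obtain ⟨q, μ, hq, h1, h2, h3, h4, h5, -⟩ :=
      exists_minimizer_multiplier hr p (c ^ 2) (-a ^ 2) (-(a ^ 2 * c ^ 2))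
    have hδ := h q hq
    obtain ⟨ε, hε, hεδ⟩ : ∃ ε, 0 < ε ∧ ε * r ^ 2 < hypEq a c q := by
      refine ⟨hypEq a c q / (2 * r ^ 2), div_pos (by linarith) (by positivity), ?_⟩
      field_simp
      linarith
    have hμ : 0 < μ := by nlinarith
    have hm : 0 < μ + ε := by linarith
    have ht : (a ^ 2 * c ^ 2) / (μ + ε) < c ^ 2 := by
      rw [div_lt_iff₀ hm]
      nlinarith [mul_pos (pow_pos hc 2) hε, mul_nonneg (pow_pos hc 2).le h2]
    have ht0 : 0 < (a ^ 2 * c ^ 2) / (μ + ε) := by positivity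
    refine ⟨_, ht0, ht, ?_⟩
    generalize htt : (a ^ 2 * c ^ 2) / (μ + ε) = t at ht ht0
    have ha2 : 0 < a ^ 2 := by positivity
    have hv := pencilEq_pencilVertex (r := r) p (t := t) (a := a) (c := c) (by linarith)
      (by linarith)
    have hpos : ∀ x, 0 < pencilEq a c r p t x := by
      intro x
      have e : (μ + ε) * t = a ^ 2 * c ^ 2 := by rw [← htt]; field_simp
      have key : (μ + ε) * sphereEq r p x + hypEq a c x = hypEq a c q + ε * sphereEq r p x +
          (c ^ 2 + μ) * ((x 0 - q 0) ^ 2 + (x 1 - q 1) ^ 2) + (-a ^ 2 + μ) * (x 2 - q 2) ^ 2 := by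
        simp only [sphereEq, hypEq] at hq ⊢
        linear_combination μ * hq + 2 * (x 0 - q 0) * h3 + 2 * (x 1 - q 1) * h4
          + 2 * (x 2 - q 2) * h5
      have hs : -r ^ 2 ≤ sphereEq r p x := by
        unfold sphereEq
        linarith [sq_nonneg (x 0 - p 0), sq_nonneg (x 1 - p 1), sq_nonneg (x 2 - p 2)]
      have h6 : 0 < (μ + ε) * sphereEq r p x + hypEq a c x := by
        rw [key]
        have : 0 ≤ (c ^ 2 + μ) * ((x 0 - q 0) ^ 2 + (x 1 - q 1) ^ 2) := by positivity
        have : 0 ≤ (-a ^ 2 + μ) * (x 2 - q 2) ^ 2 := by positivity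
        nlinarith
      have h7 : (μ + ε) * pencilEq a c r p t x =
          a ^ 2 * c ^ 2 * ((μ + ε) * sphereEq r p x + hypEq a c x) := by
        unfold pencilEq; linear_combination hypEq a c x * e
      exact pos_of_mul_pos_right (a := μ + ε) (by rw [h7]; positivity) hm.le
    have h8 : 0 < a ^ 2 * c ^ 2 * reducedCubic a c r p t := by
      rw [← hv]
      exact mul_pos (mul_pos (by linarith) (by linarith)) (hpos _)
    exact pos_of_mul_pos_right h8 (by positivity)
  · rintro ⟨t, h1, h2, h3⟩ q hq
    have := pencilEq_pos ha hc (by nlinarith) (by linarith) h3 q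
    rw [pencilEq, hq, mul_zero, zero_add] at this
    exact pos_of_mul_pos_right this h1.le

/-! ### Root positions of the cubic -/

lemma continuous_reducedCubic (a c r : ℝ) (p : Fin 3 → ℝ) : Continuous (reducedCubic a c r p) := by
  unfold reducedCubic; fun_prop

lemma exists_third_root {a c r : ℝ} {p : Fin 3 → ℝ} {x y : ℝ} (hxy : x ≠ y)
    (hx : reducedCubic a c r p x = 0) (hy : reducedCubic a c r p y = 0) :
    ∃ z, ∀ t, reducedCubic a c r p t = (t - x) * (t - y) * (t - z) := by
  unfold reducedCubic at *
  -- The third root is read off from the coefficient of `t²`.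
  refine ⟨-(a ^ 2 - c ^ 2 + r ^ 2 - (p 0 ^ 2 + p 1 ^ 2) - p 2 ^ 2) - x - y, fun t => ?_⟩
  refine mul_left_cancel₀ (sub_ne_zero.2 hxy) ?_
  linear_combination (t - y) * hx - (t - x) * hy

lemma mul_roots_eq {a c r : ℝ} {p : Fin 3 → ℝ} {x y z : ℝ}
    (h : ∀ t, reducedCubic a c r p t = (t - x) * (t - y) * (t - z)) :
    x * y * z = a ^ 2 * c ^ 2 * r ^ 2 := by
  have := h 0
  unfold reducedCubic at this
  linear_combination this

/-- The cubic is nonpositive at `-a²` and negative at `0`, so a positive value in between is flanked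
by two roots; the third is positive because the product of the roots is `a²c²r²`. In the converse
the midpoint of the two negative roots works. -/
lemma exists_pos_neg_iff {a c r : ℝ} (ha : 0 < a) (hc : 0 < c) (hr : 0 < r) (p : Fin 3 → ℝ) :
    (∃ t, -a ^ 2 < t ∧ t < 0 ∧ 0 < reducedCubic a c r p t) ↔
      ∃ l₂ l₃ l₄ : ℝ, (∀ t, reducedCubic a c r p t = (t - l₂) * (t - l₃) * (t - l₄)) ∧
        -a ^ 2 ≤ l₂ ∧ l₂ < l₃ ∧ l₃ < 0 ∧ 0 < l₄ := by
  constructor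
  · rintro ⟨t, h1, h2, h3⟩
    obtain ⟨x, ⟨hx1, hx2⟩, hx⟩ := intermediate_value_Icc h1.le
      (continuous_reducedCubic a c r p).continuousOn
      (Set.mem_Icc.2 ⟨reducedCubic_neg_sq_nonpos a c r p, h3.le⟩)
    obtain ⟨y, ⟨hy1, hy2⟩, hy⟩ := intermediate_value_Icc' h2.le
      (continuous_reducedCubic a c r p).continuousOn
      (Set.mem_Icc.2 ⟨(reducedCubic_zero_neg ha hc hr p).le, h3.le⟩)
    have hxt : x < t := lt_of_le_of_ne hx2 (by rintro rfl; exact h3.ne' hx)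
    have hy0 : y < 0 := lt_of_le_of_ne hy2 (by
      rintro rfl; exact (reducedCubic_zero_neg ha hc hr p).ne hy)
    obtain ⟨z, hz⟩ := exists_third_root (by linarith : x ≠ y) hx hy
    refine ⟨x, y, z, hz, hx1, by linarith, hy0, ?_⟩
    have h4 := mul_roots_eq hz
    refine pos_of_mul_pos_right (a := x * y) ?_ (by nlinarith)
    rw [h4]; positivity
  · rintro ⟨x, y, z, h, h1, h2, h3, h4⟩
    refine ⟨(x + y) / 2, by linarith, by linarith, ?_⟩
    rw [h]
    refine mul_pos_of_neg_of_neg (mul_neg_of_pos_of_neg ?_ ?_) ?_ <;> linarith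

lemma exists_pos_pos_iff {a c r : ℝ} (ha : 0 < a) (hc : 0 < c) (hr : 0 < r) (p : Fin 3 → ℝ) :
    (∃ t, 0 < t ∧ t < c ^ 2 ∧ 0 < reducedCubic a c r p t) ↔
      ∃ l₂ l₃ l₄ : ℝ, (∀ t, reducedCubic a c r p t = (t - l₂) * (t - l₃) * (t - l₄)) ∧
        0 < l₂ ∧ l₂ < l₃ ∧ l₃ ≤ c ^ 2 ∧ c ^ 2 ≤ l₄ := by
  constructor
  · rintro ⟨t, h1, h2, h3⟩
    obtain ⟨x, ⟨hx1, hx2⟩, hx⟩ := intermediate_value_Icc h1.le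
      (continuous_reducedCubic a c r p).continuousOn
      (Set.mem_Icc.2 ⟨(reducedCubic_zero_neg ha hc hr p).le, h3.le⟩)
    obtain ⟨y, ⟨hy1, hy2⟩, hy⟩ := intermediate_value_Icc' h2.le
      (continuous_reducedCubic a c r p).continuousOn
      (Set.mem_Icc.2 ⟨reducedCubic_sq_nonpos a c r p, h3.le⟩)
    have hxt : x < t := lt_of_le_of_ne hx2 (by rintro rfl; exact h3.ne' hx)
    have hyt : t < y := lt_of_le_of_ne hy1 (by rintro rfl; exact h3.ne' hy)
    have hx0 : 0 < x := lt_of_le_of_ne hx1 (by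
      rintro rfl; exact (reducedCubic_zero_neg ha hc hr p).ne hx)
    obtain ⟨z, hz⟩ := exists_third_root (by linarith : x ≠ y) hx hy
    have hzt : t < z := by
      by_contra! hzt
      rw [hz] at h3
      have : 0 ≤ (t - x) * (y - t) * (t - z) :=
        mul_nonneg (mul_nonneg (by linarith) (by linarith)) (by linarith)
      linarith
    -- The third root may fall below `c²`, but then `y` cannot: with all three roots below, the
    -- cubic would be positive at `c²`.
    rcases le_or_gt (c ^ 2) z with hcz | hcz
    · exact ⟨x, y, z, hz, hx0, by linarith, hy2, hcz⟩
    · refine ⟨x, z, y, fun s => by rw [hz]; ring, hx0, by linarith, hcz.le, ?_⟩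
      by_contra! hyc
      have h5 := reducedCubic_sq_nonpos a c r p
      rw [hz] at h5
      have : 0 < (c ^ 2 - x) * (c ^ 2 - y) * (c ^ 2 - z) :=
        mul_pos (mul_pos (by linarith) (by linarith)) (by linarith)
      linarith
  · rintro ⟨x, y, z, h, h1, h2, h3, h4⟩
    refine ⟨(x + y) / 2, by linarith, by linarith, ?_⟩
    rw [h]
    refine mul_pos_of_neg_of_neg (mul_neg_of_pos_of_neg ?_ ?_) ?_ <;> linarith

/-- The largest real root of the reduced cubic is at least `c²`. -/
lemma exists_root_ge {a c r : ℝ} (p : Fin 3 → ℝ) :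
    ∃ l, c ^ 2 ≤ l ∧ reducedCubic a c r p l = 0 := by
  have h1 : c ^ 2 ≤ c ^ 2 + (p 0 ^ 2 + p 1 ^ 2) + p 2 ^ 2 := by
    linarith [sq_nonneg (p 0), sq_nonneg (p 1), sq_nonneg (p 2)]
  have h2 : 0 ≤ reducedCubic a c r p (c ^ 2 + (p 0 ^ 2 + p 1 ^ 2) + p 2 ^ 2) := by
    have : reducedCubic a c r p (c ^ 2 + (p 0 ^ 2 + p 1 ^ 2) + p 2 ^ 2) =
      (c ^ 2 + (p 0 ^ 2 + p 1 ^ 2) + p 2 ^ 2 + a ^ 2) * (((p 0 ^ 2 + p 1 ^ 2) + p 2 ^ 2) * r ^ 2 +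
        (p 0 ^ 2 + p 1 ^ 2) * c ^ 2) +
      a ^ 2 * (p 0 ^ 2 + p 1 ^ 2) * (p 0 ^ 2 + p 1 ^ 2 + p 2 ^ 2) := by
      unfold reducedCubic; ring
    rw [this]; positivity
  obtain ⟨x, ⟨hx1, hx2⟩, hx⟩ := intermediate_value_Icc h1
      (continuous_reducedCubic a c r p).continuousOn
      (Set.mem_Icc.2 ⟨reducedCubic_sq_nonpos a c r p, h2⟩)
  exact ⟨x, hx1, hx⟩

/-- Dividing by a root that is at least `c²` leaves a quadratic `(t - s)² - m`, and the sign of `m`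
decides. In the real case the roots are sorted, so the largest inherits the bound `c²`. -/
lemma roots_dichotomy (a c r : ℝ) (p : Fin 3 → ℝ) :
    (∃ x y l₄, (∀ t, reducedCubic a c r p t = ((t - x) ^ 2 + y ^ 2) * (t - l₄)) ∧ y ≠ 0 ∧
      c ^ 2 ≤ l₄) ∨
    ∃ l₂ l₃ l₄, (∀ t, reducedCubic a c r p t = (t - l₂) * (t - l₃) * (t - l₄)) ∧ l₂ ≤ l₃ ∧
      l₃ ≤ l₄ ∧ c ^ 2 ≤ l₄ := by
  obtain ⟨l, hl, hl0⟩ := exists_root_ge (a := a) (c := c) (r := r) p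
  obtain ⟨s, m, hsm⟩ : ∃ s m, ∀ t, reducedCubic a c r p t = ((t - s) ^ 2 - m) * (t - l) := by
    obtain ⟨B, hB⟩ : ∃ B, B = a ^ 2 - c ^ 2 + r ^ 2 - (p 0 ^ 2 + p 1 ^ 2) - p 2 ^ 2 := ⟨_, rfl⟩
    obtain ⟨E, hE⟩ : ∃ E, E = a ^ 2 * r ^ 2 - c ^ 2 * r ^ 2 - a ^ 2 * c ^ 2 +
      (p 0 ^ 2 + p 1 ^ 2) * c ^ 2 - p 2 ^ 2 * a ^ 2 := ⟨_, rfl⟩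
    refine ⟨-(B + l) / 2, ((B + l) / 2) ^ 2 - (E + l * (B + l)), fun t => ?_⟩
    unfold reducedCubic at *
    rw [hB, hE]
    linear_combination hl0
  rcases lt_or_ge m 0 with hm | hm
  · refine Or.inl ⟨s, √(-m), l, fun t => ?_, (Real.sqrt_pos.2 (by linarith)).ne', hl⟩
    rw [hsm, Real.sq_sqrt (by linarith)]; ring
  · right
    have hs := Real.sq_sqrt hm
    have hs0 := Real.sqrt_nonneg m
    have h : ∀ t, reducedCubic a c r p t = (t - (s - √m)) * (t - (s + √m)) * (t - l) := by
      intro t; rw [hsm]; linear_combination (t - l) * hs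
    rcases le_total (s + √m) l with h1 | h1
    · exact ⟨_, _, _, h, by linarith, h1, hl⟩
    · rcases le_total (s - √m) l with h2 | h2
      · exact ⟨s - √m, l, s + √m, fun t => by rw [h]; ring, h2, h1, hl.trans h1⟩
      · exact ⟨l, s - √m, s + √m, fun t => by rw [h]; ring, h2, by linarith, hl.trans h1⟩

lemma TangentWith.third_root_ge {a c r : ℝ} (ha : 0 < a) (hc : 0 < c) {p : Fin 3 → ℝ} {t : ℝ}
    {q : Fin 3 → ℝ} (h : TangentWith a c r p t q) :
    ∃ l, c ^ 2 ≤ l ∧ ∀ x, reducedCubic a c r p x = (x - t) * (x - t) * (x - l) :=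
  ⟨_, le_add_of_nonneg_right (by positivity), h.reducedCubic_eq ha hc⟩

/-! ### Tangency at a single common point -/

section DoubleRoot

variable {a c r : ℝ} {p : Fin 3 → ℝ} {t l : ℝ}

lemma pencilEq_nonneg_of_double_root (h : reducedCubic a c r p t = 0) (h1 : 0 < t + a ^ 2)
    (h2 : 0 < c ^ 2 - t) (x : Fin 3 → ℝ) : 0 ≤ pencilEq a c r p t x := by
  have := mul_pencilEq a c r p t x
  have h3 : 0 ≤ (t + a ^ 2) * (c ^ 2 - t) * pencilEq a c r p t x := by
    rw [this, h]; positivity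
  exact nonneg_of_mul_nonneg_right h3 (mul_pos h1 h2)

lemma eq_pencilVertex_of_double_root (ha : 0 < a) (hc : 0 < c) (h : reducedCubic a c r p t = 0)
    (h1 : 0 < t + a ^ 2) (h2 : 0 < c ^ 2 - t) {x : Fin 3 → ℝ} (hx : pencilEq a c r p t x = 0) :
    x = pencilVertex a c p t := by
  have := mul_pencilEq a c r p t x
  rw [h, hx] at this
  have e0 : 0 ≤ (c ^ 2 - t) * c ^ 2 * ((t + a ^ 2) * x 0 - a ^ 2 * p 0) ^ 2 := by positivity
  have e1 : 0 ≤ (c ^ 2 - t) * c ^ 2 * ((t + a ^ 2) * x 1 - a ^ 2 * p 1) ^ 2 := by positivity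
  have e2 : 0 ≤ (t + a ^ 2) * a ^ 2 * ((c ^ 2 - t) * x 2 - c ^ 2 * p 2) ^ 2 := by positivity
  have f0 : (c ^ 2 - t) * c ^ 2 * ((t + a ^ 2) * x 0 - a ^ 2 * p 0) ^ 2 = 0 := by linarith
  have f1 : (c ^ 2 - t) * c ^ 2 * ((t + a ^ 2) * x 1 - a ^ 2 * p 1) ^ 2 = 0 := by linarith
  have f2 : (t + a ^ 2) * a ^ 2 * ((c ^ 2 - t) * x 2 - c ^ 2 * p 2) ^ 2 = 0 := by linarith
  simp only [mul_eq_zero, h2.ne', h1.ne', pow_eq_zero_iff two_ne_zero, hc.ne', ha.ne',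
    false_or] at f0 f1 f2
  ext i
  fin_cases i <;> simp [pencilVertex] <;> field_simp <;> linarith

end DoubleRoot

lemma simplyTangent_iff {a c r : ℝ} (ha : 0 < a) (hc : 0 < c) (hr : 0 < r) {p : Fin 3 → ℝ} :
    SimplyTangent (hyperboloidMatrix a c) (sphereMatrix p r) ↔
      ∃ q t, TangentWith a c r p t q ∧ ∀ x, hypEq a c x = 0 → sphereEq r p x = 0 → x = q := by
  simp only [SimplyTangent, tangentAt_iff ha hc hr, Set.eq_singleton_iff_unique_mem,
    mem_inter_quadricSurface ha hc]
  constructor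
  · rintro ⟨q, ⟨t, ht⟩, -, h⟩
    exact ⟨q, t, ht, fun x h1 h2 => h x ⟨h1, h2⟩⟩
  · rintro ⟨q, t, ht, h⟩
    exact ⟨q, ⟨t, ht⟩, ⟨ht.1, ht.2.1⟩, fun x hx => h x hx.1 hx.2⟩

/-- A unique contact makes `0` the maximum of `hypEq` on the sphere, and the multiplier there yields
the double root. Conversely, the member at the double root is nonnegative with its vertex as only
zero, so contact occurs only there. -/
lemma typeTI_iff_roots {a c r : ℝ} (ha : 0 < a) (hc : 0 < c) (hr : 0 < r) (p : Fin 3 → ℝ) :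
    TypeTI a c r p ↔
      ∃ t l : ℝ, (∀ x, reducedCubic a c r p x = (x - t) * (x - t) * (x - l)) ∧
        -a ^ 2 < t ∧ t < 0 ∧ 0 < l := by
  rw [TypeTI, simplyTangent_iff ha hc hr, isInteriorPoint_hyperboloidMatrix ha hc]
  have hc2 : 0 < c ^ 2 := by positivity
  constructor
  · rintro ⟨⟨q₀, -, ⟨hq1, hq2, -⟩, hu⟩, hp⟩
    have hle : ∀ x, sphereEq r p x = 0 → hypEq a c x ≤ 0 := by
      by_contra! hx
      obtain ⟨x, hx1, hx2⟩ := hx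
      have : ∃ y, sphereEq r p y = 0 ∧ hypEq a c y < 0 := by
        by_contra! hy
        exact absurd (hypEq_center_pos ha hr hy) (by linarith)
      obtain ⟨y, hy1, hy2⟩ := this
      obtain ⟨u, v, huv, hu1, hv1, hu2, hv2⟩ :=
        exists_two_zeros hr (continuous_hypEq a c) hy1 hx1 hy2 hx2
      exact huv ((hu u hu2 hu1).trans (hu v hv2 hv1).symm)
    obtain ⟨q, μ, hq, h1, h2, h3, h4, h5, hmin⟩ :=
      exists_minimizer_multiplier hr p (-c ^ 2) (a ^ 2) (a ^ 2 * c ^ 2)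
    have hq0 : hypEq a c q = 0 := by
      refine le_antisymm (hle q hq) ?_
      have := hmin q₀ hq2
      unfold hypEq at hq1 ⊢
      linarith
    have hμ : 0 < μ := by linarith
    -- The boundary case `μ = c²` puts the centre on the axis; uniqueness under the half-turn about
    -- the axis would put the contact point on the axis, which misses the hyperboloid.
    have hne : -c ^ 2 + μ ≠ 0 := by
      intro h0
      have hμc : μ = c ^ 2 := by linarith
      subst hμc
      have p0 : p 0 = 0 := by
        have : c ^ 2 * p 0 = 0 := by linarith
        simpa [hc.ne'] using this
      have p1 : p 1 = 0 := by
        have : c ^ 2 * p 1 = 0 := by linarith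
        simpa [hc.ne'] using this
      have e := (hu q hq0 hq).trans (hu ![-q 0, -q 1, q 2] (by simpa [hypEq] using hq0) (by
        simp only [sphereEq, p0, p1] at hq
        simp [sphereEq, p0, p1]; linarith)).symm
      have e0 : q 0 = -q 0 := by simpa using congrFun e 0
      have e1 : q 1 = -q 1 := by simpa using congrFun e 1
      have e0 : q 0 = 0 := by linarith
      have e1 : q 1 = 0 := by linarith
      have : 0 < a ^ 2 * c ^ 2 := by positivity
      simp only [hypEq, e0, e1] at hq0
      nlinarith [mul_nonneg (sq_nonneg a) (sq_nonneg (q 2))]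
    have hlt : 0 < -c ^ 2 + μ := lt_of_le_of_ne h1 (Ne.symm hne)
    -- `μ·sphereEq - hypEq` is proportional to the pencil member with parameter `-a²c²/μ`.
    have hT : TangentWith a c r p (-(a ^ 2 * c ^ 2) / μ) q := by
      refine ⟨hq0, hq, ?_, ?_, ?_⟩
      · field_simp; linear_combination h3
      · field_simp; linear_combination h4
      · field_simp; linear_combination h5
    obtain ⟨l, hl, h⟩ := hT.third_root_ge ha hc
    refine ⟨_, l, h, ?_, ?_, by linarith⟩
    · rw [lt_div_iff₀ hμ]
      nlinarith [mul_pos (pow_pos ha 2) hlt]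
    · exact div_neg_of_neg_of_pos (neg_lt_zero.2 (by positivity)) hμ
  · rintro ⟨t, l, h, h1, h2, h3⟩
    have h0 : reducedCubic a c r p t = 0 := by rw [h]; ring
    have hα : 0 < t + a ^ 2 := by linarith
    have hβ : 0 < c ^ 2 - t := by linarith
    refine ⟨⟨_, t, tangentWith_pencilVertex ha hc h hα.ne' hβ.ne', fun x hx hx' => ?_⟩, ?_⟩
    · exact eq_pencilVertex_of_double_root ha hc h0 hα hβ (by simp [pencilEq, hx, hx'])
    · refine hypEq_center_neg hc hr fun q hq => ?_
      have := pencilEq_nonneg_of_double_root h0 hα hβ q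
      rw [pencilEq, hq, mul_zero, zero_add] at this
      nlinarith

lemma typeTE_iff_roots {a c r : ℝ} (ha : 0 < a) (hc : 0 < c) (hr : 0 < r) (p : Fin 3 → ℝ) :
    TypeTE a c r p ↔
      ∃ t l : ℝ, (∀ x, reducedCubic a c r p x = (x - t) * (x - t) * (x - l)) ∧
        ((0 < t ∧ t < l ∧ t < c ^ 2) ∨ (t = c ^ 2 ∧ l = c ^ 2)) := by
  rw [TypeTE, simplyTangent_iff ha hc hr, isExteriorPoint_hyperboloidMatrix ha hc]
  have hc2 : 0 < c ^ 2 := by positivity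
  have ha2 : 0 < a ^ 2 := by positivity
  constructor
  · rintro ⟨⟨q₀, -, ⟨hq1, hq2, -⟩, hu⟩, hp⟩
    have hle : ∀ x, sphereEq r p x = 0 → 0 ≤ hypEq a c x := by
      by_contra! hx
      obtain ⟨x, hx1, hx2⟩ := hx
      have : ∃ y, sphereEq r p y = 0 ∧ 0 < hypEq a c y := by
        by_contra! hy
        exact absurd (hypEq_center_neg hc hr hy) (by linarith)
      obtain ⟨y, hy1, hy2⟩ := this
      obtain ⟨u, v, huv, hu1, hv1, hu2, hv2⟩ :=
        exists_two_zeros hr (continuous_hypEq a c) hx1 hy1 hx2 hy2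
      exact huv ((hu u hu2 hu1).trans (hu v hv2 hv1).symm)
    obtain ⟨q, μ, hq, h1, h2, h3, h4, h5, hmin⟩ :=
      exists_minimizer_multiplier hr p (c ^ 2) (-a ^ 2) (-(a ^ 2 * c ^ 2))
    have hq0 : hypEq a c q = 0 := by
      refine le_antisymm ?_ (hle q hq)
      have := hmin q₀ hq2
      unfold hypEq at hq1 ⊢
      linarith
    have hμ : 0 < μ := by linarith
    have hT : TangentWith a c r p ((a ^ 2 * c ^ 2) / μ) q := by
      refine ⟨hq0, hq, ?_, ?_, ?_⟩
      · field_simp; linear_combination h3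
      · field_simp; linear_combination h4
      · field_simp; linear_combination h5
    refine ⟨_, _, hT.reducedCubic_eq ha hc, ?_⟩
    -- Equality means parameter `c²` and centre in the plane `z = 0`. Uniqueness under reflection in
    -- this plane gives `q 2 = 0`, so the third root is `c²` as well.
    rcases h2.eq_or_lt with h0 | hlt
    · right
      have hμa : μ = a ^ 2 := by linarith
      subst hμa
      have p2 : p 2 = 0 := by
        have : a ^ 2 * p 2 = 0 := by linarith
        simpa [ha.ne'] using this
      have e := (hu q hq0 hq).trans (hu ![q 0, q 1, -q 2] (by simpa [hypEq] using hq0) (by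
        simp only [sphereEq, p2] at hq
        simp [sphereEq, p2]; linarith)).symm
      have e2 : q 2 = -q 2 := by simpa using congrFun e 2
      have e2 : q 2 = 0 := by linarith
      refine ⟨by field_simp, by simp [e2]⟩
    · left
      have ht : a ^ 2 * c ^ 2 / μ < c ^ 2 := by
        rw [div_lt_iff₀ hμ]
        nlinarith [mul_pos hc2 hlt]
      refine ⟨by positivity, ht.trans_le (le_add_of_nonneg_right (by positivity)), ht⟩
  · rintro ⟨t, l, h, ⟨h1, h2, h3⟩ | ⟨rfl, rfl⟩⟩
    · have h0 : reducedCubic a c r p t = 0 := by rw [h]; ring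
      have hα : 0 < t + a ^ 2 := by linarith
      have hβ : 0 < c ^ 2 - t := by linarith
      refine ⟨⟨_, t, tangentWith_pencilVertex ha hc h hα.ne' hβ.ne', fun x hx hx' => ?_⟩, ?_⟩
      · exact eq_pencilVertex_of_double_root ha hc h0 hα hβ (by simp [pencilEq, hx, hx'])
      · refine hypEq_center_pos ha hr fun q hq => ?_
        have := pencilEq_nonneg_of_double_root h0 hα hβ q
        rw [pencilEq, hq, mul_zero, zero_add] at this
        exact nonneg_of_mul_nonneg_right this h1
    · have p2 : p 2 = 0 := by
        have := reducedCubic_sq a c r p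
        rw [h, sub_self, zero_mul, zero_mul] at this
        have : p 2 ^ 2 * (c ^ 2 * (a ^ 2 + c ^ 2)) = 0 := by linarith
        have h' : c ^ 2 * (a ^ 2 + c ^ 2) ≠ 0 := by positivity
        simpa [h'] using this
      have har : a ^ 2 * r ^ 2 = c ^ 4 := by
        have := h 0
        simp only [reducedCubic, p2] at this
        have h' : c ^ 2 * (a ^ 2 * r ^ 2) = c ^ 2 * c ^ 4 := by linarith
        exact mul_left_cancel₀ hc2.ne' h'
      have hD : p 0 ^ 2 + p 1 ^ 2 = a ^ 2 + r ^ 2 + 2 * c ^ 2 := by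
        have := h (2 * c ^ 2)
        simp only [reducedCubic, p2] at this
        have h' : 2 * c ^ 2 * c ^ 2 * (p 0 ^ 2 + p 1 ^ 2) =
            2 * c ^ 2 * c ^ 2 * (a ^ 2 + r ^ 2 + 2 * c ^ 2) := by
          linear_combination -this + c ^ 2 * har
        exact mul_left_cancel₀ (by positivity) h'
      -- At a triple root `c²` the member does not depend on height and vanishes only on a vertical
      -- line, which touches the hyperboloid only at height `0`.
      have hL : ∀ x, (a ^ 2 + c ^ 2) * pencilEq a c r p (c ^ 2) x =
          c ^ 2 * (((a ^ 2 + c ^ 2) * x 0 - a ^ 2 * p 0) ^ 2 +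
            ((a ^ 2 + c ^ 2) * x 1 - a ^ 2 * p 1) ^ 2) := by
        intro x
        simp only [pencilEq, sphereEq, hypEq, p2]
        linear_combination a ^ 2 * c ^ 4 * hD - a ^ 2 * c ^ 2 * har
      have hα : a ^ 2 + c ^ 2 ≠ 0 := by positivity
      have hT : TangentWith a c r p (c ^ 2)
          ![a ^ 2 * p 0 / (a ^ 2 + c ^ 2), a ^ 2 * p 1 / (a ^ 2 + c ^ 2), 0] := by
        have hη : hypEq a c
            ![a ^ 2 * p 0 / (a ^ 2 + c ^ 2), a ^ 2 * p 1 / (a ^ 2 + c ^ 2), 0] = 0 := by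
          simp [hypEq]
          field_simp
          linear_combination c ^ 2 * a ^ 2 * (a ^ 2 * hD + har)
        refine ⟨hη, ?_, ?_, ?_, ?_⟩
        · have := hL ![a ^ 2 * p 0 / (a ^ 2 + c ^ 2), a ^ 2 * p 1 / (a ^ 2 + c ^ 2), 0]
          rw [pencilEq, hη] at this
          have e0 : (a ^ 2 + c ^ 2) * (a ^ 2 * p 0 / (a ^ 2 + c ^ 2)) = a ^ 2 * p 0 := by
            field_simp
          have e1 : (a ^ 2 + c ^ 2) * (a ^ 2 * p 1 / (a ^ 2 + c ^ 2)) = a ^ 2 * p 1 := by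
            field_simp
          simpa [e0, e1, hα, ha.ne', hc.ne'] using this
        · simp; field_simp; ring
        · simp; field_simp; ring
        · simp [p2]
      refine ⟨⟨_, _, hT, fun x hx hx' => ?_⟩, ?_⟩
      · have := hL x
        rw [pencilEq, hx, hx'] at this
        have h1 : ((a ^ 2 + c ^ 2) * x 0 - a ^ 2 * p 0) ^ 2 +
            ((a ^ 2 + c ^ 2) * x 1 - a ^ 2 * p 1) ^ 2 = 0 := by
          simpa [hc.ne'] using this.symm
        have e0 : ((a ^ 2 + c ^ 2) * x 0 - a ^ 2 * p 0) ^ 2 = 0 := by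
          linarith [sq_nonneg ((a ^ 2 + c ^ 2) * x 0 - a ^ 2 * p 0),
            sq_nonneg ((a ^ 2 + c ^ 2) * x 1 - a ^ 2 * p 1)]
        have e1 : ((a ^ 2 + c ^ 2) * x 1 - a ^ 2 * p 1) ^ 2 = 0 := by linarith
        rw [pow_eq_zero_iff two_ne_zero] at e0 e1
        have hx0 : x 0 = a ^ 2 * p 0 / (a ^ 2 + c ^ 2) := by field_simp; linarith
        have hx1 : x 1 = a ^ 2 * p 1 / (a ^ 2 + c ^ 2) := by field_simp; linarith
        have hx2 : x 2 = 0 := by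
          have h2 := hT.1
          simp only [hypEq, hx0, hx1] at hx h2
          simp at h2
          have : a ^ 2 * x 2 ^ 2 = 0 := by linarith
          simpa [ha.ne'] using this
        ext i
        fin_cases i <;> simp [hx0, hx1, hx2]
      · refine hypEq_center_pos ha hr fun q hq => ?_
        have := hL q
        rw [pencilEq, hq, mul_zero, zero_add] at this
        have h1 : 0 ≤ (a ^ 2 + c ^ 2) * c ^ 2 * hypEq a c q := by
          rw [mul_assoc, this]; positivity
        exact nonneg_of_mul_nonneg_right h1 (by positivity)

/-! ### Degenerate double roots and the case of real roots -/

/-- A double root of the reduced cubic comes from a tangency, unless it is `c²` and the third root is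
smaller. -/
lemma exists_tangentWith_of_double_root {a c r : ℝ} (ha : 0 < a) (hc : 0 < c) {p : Fin 3 → ℝ}
    {t l : ℝ} (h : ∀ x, reducedCubic a c r p x = (x - t) * (x - t) * (x - l))
    (hl : c ^ 2 ≤ l) : ∃ q, TangentWith a c r p t q := by
  have hc2 : 0 < c ^ 2 := by positivity
  have ha2 : 0 < a ^ 2 := by positivity
  have hac : a ^ 2 + c ^ 2 ≠ 0 := by positivity
  -- At `t = -a²` the centre is on the axis and the horizontal gradient equations are void. The
  -- vertical one fixes the height `z`, and `ρ` is chosen to place `(ρ, 0, z)` on the hyperboloid.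
  by_cases h1 : t + a ^ 2 = 0
  · have ht : t = -a ^ 2 := by linarith
    subst ht
    have hp : p 0 ^ 2 + p 1 ^ 2 = 0 := by
      have := reducedCubic_neg_sq a c r p
      rw [h, sub_self, zero_mul, zero_mul] at this
      have h' : a ^ 2 * (a ^ 2 + c ^ 2) ≠ 0 := by positivity
      have : (p 0 ^ 2 + p 1 ^ 2) * (a ^ 2 * (a ^ 2 + c ^ 2)) = 0 := by linarith
      simpa [h'] using this
    have p0 : p 0 = 0 := by nlinarith [sq_nonneg (p 0), sq_nonneg (p 1)]
    have p1 : p 1 = 0 := by nlinarith [sq_nonneg (p 0), sq_nonneg (p 1)]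
    have hk : (a ^ 2 + c ^ 2) * (r ^ 2 - a ^ 2) = a ^ 2 * p 2 ^ 2 := by
      have e0 := h 0
      have e1 := h (a ^ 2)
      have e2 := h (2 * a ^ 2)
      simp only [reducedCubic, p0, p1] at e0 e1 e2
      have : a ^ 2 * ((a ^ 2 + c ^ 2) * (r ^ 2 - a ^ 2)) = a ^ 2 * (a ^ 2 * p 2 ^ 2) := by
        linear_combination -3 * e0 + 3 / 2 * e1 - 1 / 3 * e2
      exact mul_left_cancel₀ ha2.ne' this
    obtain ⟨z, hz⟩ : ∃ z, (a ^ 2 + c ^ 2) * z = c ^ 2 * p 2 :=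
      ⟨c ^ 2 * p 2 / (a ^ 2 + c ^ 2), by field_simp⟩
    have hρ := Real.sq_sqrt (show 0 ≤ a ^ 2 * (1 + z ^ 2 / c ^ 2) by positivity)
    generalize √(a ^ 2 * (1 + z ^ 2 / c ^ 2)) = ρ at hρ
    have hρ' : c ^ 2 * ρ ^ 2 = a ^ 2 * (c ^ 2 + z ^ 2) := by rw [hρ]; field_simp
    refine ⟨![ρ, 0, z], ?_, ?_, ?_, ?_, ?_⟩
    · simp [hypEq]; linear_combination hρ'
    · have : c ^ 2 * (a ^ 2 + c ^ 2) * sphereEq r p ![ρ, 0, z] = 0 := by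
        simp only [sphereEq, Matrix.cons_val, p0, p1]
        linear_combination (a ^ 2 + c ^ 2) * hρ' + (a ^ 2 + c ^ 2) * z * hz - c ^ 2 * p 2 * hz - c ^ 2 * hk
      have h' : c ^ 2 * (a ^ 2 + c ^ 2) ≠ 0 := by positivity
      simpa [h'] using this
    · simp [p0]
    · simp [p1]
    · simp; linear_combination hz
  -- At `t = c²` the vertical equation is void. The height is found by solving `l = c² + z²(1 +
  -- a²/c²)`, which needs `c² ≤ l`.
  by_cases h2 : c ^ 2 - t = 0
  · have ht : t = c ^ 2 := by linarith
    subst ht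
    have p2 : p 2 = 0 := by
      have := reducedCubic_sq a c r p
      rw [h, sub_self, zero_mul, zero_mul] at this
      have : p 2 ^ 2 * (c ^ 2 * (a ^ 2 + c ^ 2)) = 0 := by linarith
      have h' : c ^ 2 * (a ^ 2 + c ^ 2) ≠ 0 := by positivity
      simpa [h'] using this
    have har : a ^ 2 * r ^ 2 = c ^ 2 * l := by
      have := mul_roots_eq h
      have h' : c ^ 2 * (a ^ 2 * r ^ 2) = c ^ 2 * (c ^ 2 * l) := by linarith
      exact mul_left_cancel₀ hc2.ne' h'
    have hD : p 0 ^ 2 + p 1 ^ 2 = a ^ 2 + r ^ 2 + c ^ 2 + l := by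
      have := h (2 * c ^ 2)
      simp only [reducedCubic, p2] at this
      have h' : 2 * c ^ 2 * c ^ 2 * (p 0 ^ 2 + p 1 ^ 2) =
          2 * c ^ 2 * c ^ 2 * (a ^ 2 + r ^ 2 + c ^ 2 + l) := by
        linear_combination -this + c ^ 2 * har
      exact mul_left_cancel₀ (by positivity) h'
    have haD : a ^ 2 * (p 0 ^ 2 + p 1 ^ 2) = (a ^ 2 + c ^ 2) * (a ^ 2 + l) := by
      linear_combination a ^ 2 * hD + har
    obtain ⟨x, hx⟩ : ∃ x, (a ^ 2 + c ^ 2) * x = a ^ 2 * p 0 :=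
      ⟨a ^ 2 * p 0 / (a ^ 2 + c ^ 2), by field_simp⟩
    obtain ⟨y, hy⟩ : ∃ y, (a ^ 2 + c ^ 2) * y = a ^ 2 * p 1 :=
      ⟨a ^ 2 * p 1 / (a ^ 2 + c ^ 2), by field_simp⟩
    have hxy : (a ^ 2 + c ^ 2) * (x ^ 2 + y ^ 2) = a ^ 2 * (a ^ 2 + l) := by
      refine mul_left_cancel₀ hac ?_
      linear_combination a ^ 2 * haD + ((a ^ 2 + c ^ 2) * x + a ^ 2 * p 0) * hx +
        ((a ^ 2 + c ^ 2) * y + a ^ 2 * p 1) * hy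
    have hz : 0 ≤ c ^ 2 * (l - c ^ 2) / (a ^ 2 + c ^ 2) :=
      div_nonneg (mul_nonneg hc2.le (by linarith)) (by positivity)
    have hρ := Real.sq_sqrt hz
    generalize √(c ^ 2 * (l - c ^ 2) / (a ^ 2 + c ^ 2)) = z at hρ
    have hρ' : (a ^ 2 + c ^ 2) * z ^ 2 = c ^ 2 * (l - c ^ 2) := by rw [hρ]; field_simp
    refine ⟨![x, y, z], ?_, ?_, ?_, ?_, ?_⟩
    · have : (a ^ 2 + c ^ 2) * hypEq a c ![x, y, z] = 0 := by
        simp only [hypEq, Matrix.cons_val]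
        linear_combination c ^ 2 * hxy - a ^ 2 * hρ'
      simpa [hac] using this
    · have : a ^ 2 * (a ^ 2 + c ^ 2) * sphereEq r p ![x, y, z] = 0 := by
        simp only [sphereEq, Matrix.cons_val, p2]
        linear_combination (a ^ 2 - 2 * (a ^ 2 + c ^ 2)) * hxy + a ^ 2 * hρ' +
          2 * (a ^ 2 + c ^ 2) * x * hx + 2 * (a ^ 2 + c ^ 2) * y * hy + (a ^ 2 + c ^ 2) * haD -
          (a ^ 2 + c ^ 2) * har
      have h' : a ^ 2 * (a ^ 2 + c ^ 2) ≠ 0 := by positivity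
      simpa [h'] using this
    · simp; linear_combination hx
    · simp; linear_combination hy
    · simp [p2]
  · exact ⟨_, tangentWith_pencilVertex ha hc h h1 h2⟩

/-- If the roots of the reduced cubic are real, then there is no contact, or there is a tangency, or
the roots lie in one of two special positions. -/
lemma real_roots_cases {a c r : ℝ} (ha : 0 < a) (hc : 0 < c) (hr : 0 < r) {p : Fin 3 → ℝ}
    {l₂ l₃ l₄ : ℝ} (h : ∀ t, reducedCubic a c r p t = (t - l₂) * (t - l₃) * (t - l₄))
    (h23 : l₂ ≤ l₃) (h34 : l₃ ≤ l₄) (h4 : c ^ 2 ≤ l₄) :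
    (¬ ∃ q, hypEq a c q = 0 ∧ sphereEq r p q = 0) ∨ (∃ q t, TangentWith a c r p t q) ∨
      (l₂ < l₃ ∧ l₃ ≤ -a ^ 2) ∨ (c ^ 2 ≤ l₂ ∧ l₂ < l₃ ∧ l₃ < l₄) := by
  have hc2 : 0 < c ^ 2 := by positivity
  have ha2 : 0 < a ^ 2 := by positivity
  have hprod := mul_roots_eq h
  have hpos : 0 < l₂ * l₃ := by
    refine pos_of_mul_pos_left (b := l₄) ?_ (by linarith)
    rw [hprod]; positivity
  rcases h23.eq_or_lt with rfl | h23'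
  · obtain ⟨q, hq⟩ := exists_tangentWith_of_double_root ha hc h h4
    exact Or.inr (Or.inl ⟨q, _, hq⟩)
  rcases lt_or_ge l₂ 0 with h2 | h2
  · have h3 : l₃ < 0 := by
      by_contra! h3
      nlinarith
    rcases le_or_gt (-a ^ 2) l₂ with hal | hal
    · left
      rintro ⟨q, hq1, hq2⟩
      have := (forall_hypEq_neg_iff ha hc hr).2 ((exists_pos_neg_iff ha hc hr p).2
        ⟨l₂, l₃, l₄, h, hal, h23', h3, by linarith⟩) q hq2
      linarith
    -- If `-a²` lay strictly between the two negative roots, the cubic would be positive there.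
    · refine Or.inr (Or.inr (Or.inl ⟨h23', ?_⟩))
      by_contra! h3'
      have h5 := reducedCubic_neg_sq_nonpos a c r p
      rw [h] at h5
      have : 0 < (-a ^ 2 - l₂) * (-a ^ 2 - l₃) * (-a ^ 2 - l₄) :=
        mul_pos_of_neg_of_neg (mul_neg_of_pos_of_neg (by linarith) (by linarith)) (by linarith)
      linarith
  · have h2' : 0 < l₂ := lt_of_le_of_ne h2 (by rintro rfl; simp at hpos)
    rcases le_or_gt l₃ (c ^ 2) with h3 | h3
    · left
      rintro ⟨q, hq1, hq2⟩
      have := (forall_hypEq_pos_iff ha hc hr).2 ((exists_pos_pos_iff ha hc hr p).2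
        ⟨l₂, l₃, l₄, h, h2', h23', h3, h4⟩) q hq2
      linarith
    · rcases h34.eq_or_lt with rfl | h34'
      · exact Or.inr (Or.inl ⟨_, _, tangentWith_pencilVertex (t := l₃) (l := l₂) ha hc
          (fun x => by rw [h]; ring) (by linarith) (by linarith)⟩)
      · refine Or.inr (Or.inr (Or.inr ⟨?_, h23', h34'⟩))
        by_contra! h2c
        have h5 := reducedCubic_sq_nonpos a c r p
        rw [h] at h5
        have : 0 < (c ^ 2 - l₂) * (c ^ 2 - l₃) * (c ^ 2 - l₄) := by
          rw [mul_assoc]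
          exact mul_pos (by linarith) (mul_pos_of_neg_of_neg (by linarith) (by linarith))
        linarith

/-! ### Root positions with a disconnected intersection -/

/-- The second intersection of the sphere with the line that joins the pencil vertex at the root `m`
to a common point `q` is a common point, on the other side of the plane that separates
the two sheets of the pencil member `t`. -/
lemma exists_neg_partner {a c r : ℝ} (ha : 0 < a) (hc : 0 < c) {p q : Fin 3 → ℝ} {t m : ℝ}
    (hm' : c ^ 2 < m) (hm0 : reducedCubic a c r p m = 0) (hβ0 : c ^ 2 - t ≠ 0)
    (hαm : 0 < (t + a ^ 2) * (t - m)) (hη : hypEq a c (pencilVertex a c p m) < 0)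
    (hT : ∀ x : Fin 3 → ℝ, (c ^ 2 - t) * x 2 - c ^ 2 * p 2 = 0 →
      0 < (t + a ^ 2) * pencilEq a c r p t x)
    (hq1 : hypEq a c q = 0) (hq2 : sphereEq r p q = 0) :
    ∃ q', hypEq a c q' = 0 ∧ sphereEq r p q' = 0 ∧
      ((c ^ 2 - t) * q 2 - c ^ 2 * p 2) * ((c ^ 2 - t) * q' 2 - c ^ 2 * p 2) < 0 := by
  have hc2 : 0 < c ^ 2 := by positivity
  have ha2 : 0 < a ^ 2 := by positivity
  have hm1 : m + a ^ 2 ≠ 0 := by linarith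
  have hm2 : c ^ 2 - m ≠ 0 := by linarith
  obtain ⟨v, hv⟩ : ∃ v, v = pencilVertex a c p m := ⟨_, rfl⟩
  rw [← hv] at hη
  have hLv : pencilEq a c r p m v = 0 := by
    have := pencilEq_pencilVertex (r := r) p hm1 hm2
    rw [hm0, mul_zero, ← hv] at this
    simpa [hm1, hm2] using this
  have hv0 : (m + a ^ 2) * v 0 = a ^ 2 * p 0 := by rw [hv]; simp [pencilVertex]; field_simp
  have hv1 : (m + a ^ 2) * v 1 = a ^ 2 * p 1 := by rw [hv]; simp [pencilVertex]; field_simp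
  have hv2 : (c ^ 2 - m) * v 2 = c ^ 2 * p 2 := by rw [hv]; simp [pencilVertex]; field_simp
  have hac : 0 < a ^ 2 * c ^ 2 := by positivity
  -- The apex `v` is interior to the hyperboloid and lies on the member `m > 0`, hence is outside
  -- the sphere. This later makes `k` positive.
  have hs : 0 < sphereEq r p v := by
    unfold pencilEq at hLv
    have : 0 < a ^ 2 * c ^ 2 * sphereEq r p v := by nlinarith
    exact pos_of_mul_pos_right this hac.le
  have hTv : (t + a ^ 2) * pencilEq a c r p t v < 0 := by
    have : (t + a ^ 2) * pencilEq a c r p t v = (t + a ^ 2) * (t - m) * hypEq a c v := by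
      unfold pencilEq at *
      linear_combination (t + a ^ 2) * hLv
    rw [this]
    exact mul_neg_of_pos_of_neg hαm hη
  -- the line from the vertex `v` through `q`
  obtain ⟨u₀, hu₀⟩ : ∃ u, u = q 0 - v 0 := ⟨_, rfl⟩
  obtain ⟨u₁, hu₁⟩ : ∃ u, u = q 1 - v 1 := ⟨_, rfl⟩
  obtain ⟨u₂, hu₂⟩ : ∃ u, u = q 2 - v 2 := ⟨_, rfl⟩
  have hq0 : q 0 = v 0 + u₀ := by linarith
  have hq1' : q 1 = v 1 + u₁ := by linarith
  have hq2' : q 2 = v 2 + u₂ := by linarith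
  have hcone : c ^ 2 * (m + a ^ 2) * (u₀ ^ 2 + u₁ ^ 2) + a ^ 2 * (c ^ 2 - m) * u₂ ^ 2 = 0 := by
    have h1 : pencilEq a c r p m q = 0 := by simp [pencilEq, hq1, hq2]
    unfold pencilEq sphereEq hypEq at h1 hLv
    rw [hq0, hq1', hq2'] at h1
    linear_combination h1 - hLv - 2 * c ^ 2 * u₀ * hv0 - 2 * c ^ 2 * u₁ * hv1 - 2 * a ^ 2 * u₂ * hv2
  obtain ⟨N, hN⟩ : ∃ N, N = u₀ ^ 2 + u₁ ^ 2 + u₂ ^ 2 := ⟨_, rfl⟩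
  have hN0 : 0 < N := by
    rcases (show 0 ≤ N by rw [hN]; positivity).eq_or_lt with h0 | h0
    · exfalso
      obtain ⟨e0, e1, e2⟩ := eq_zero_of_sum_sq_eq_zero (hN.symm.trans h0.symm)
      have : q = v := by
        ext i
        fin_cases i <;> simp [hq0, hq1', hq2', e0, e1, e2]
      rw [← this, hq1] at hη
      exact hη.false
    · exact h0
  -- The line meets the sphere at parameters `1` (the point `q`) and `k`, whose product is the value
  -- of `sphereEq` at `v` divided by `N`.
  obtain ⟨k, hk⟩ : ∃ k, k * N = sphereEq r p v := ⟨sphereEq r p v / N, by field_simp⟩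
  have hk0 : 0 < k := pos_of_mul_pos_left (hk ▸ hs) hN0.le
  have hline : ∀ x, sphereEq r p ![v 0 + x * u₀, v 1 + x * u₁, v 2 + x * u₂] =
      N * ((x - 1) * (x - k)) := by
    intro x
    have e1 : sphereEq r p ![v 0 + x * u₀, v 1 + x * u₁, v 2 + x * u₂] =
        (1 - x) * sphereEq r p v + x * sphereEq r p q + (x ^ 2 - x) * N := by
      rw [hN]
      simp [sphereEq, hq0, hq1', hq2']
      ring
    rw [e1, hq2, ← hk]; ring
  have hmline : ∀ x, pencilEq a c r p m ![v 0 + x * u₀, v 1 + x * u₁, v 2 + x * u₂] = 0 := by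
    intro x
    have e1 : pencilEq a c r p m ![v 0 + x * u₀, v 1 + x * u₁, v 2 + x * u₂] =
        (1 - x) * pencilEq a c r p m v + x * pencilEq a c r p m q + (x ^ 2 - x) *
        (c ^ 2 * (m + a ^ 2) * (u₀ ^ 2 + u₁ ^ 2) + a ^ 2 * (c ^ 2 - m) * u₂ ^ 2) := by
      simp [pencilEq, hypEq, sphereEq, hq0, hq1', hq2']
      ring
    rw [e1, hLv, hcone]
    simp [pencilEq, hq1, hq2]
  have hm0' : 0 < m := by linarith
  -- The whole line lies on the cone `m`, so along it every pencil member is a multiple of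
  -- `sphereEq`. The factor is fixed by the value at `v`.
  have hpline : ∀ x, (t + a ^ 2) * pencilEq a c r p t
      ![v 0 + x * u₀, v 1 + x * u₁, v 2 + x * u₂] * k =
      (t + a ^ 2) * pencilEq a c r p t v * ((x - 1) * (x - k)) := by
    intro x
    have e1 := hmline x
    have e2 := hline x
    unfold pencilEq at e1 hLv ⊢
    refine mul_left_cancel₀ hm0'.ne' ?_
    rw [e2] at e1 ⊢
    linear_combination (t + a ^ 2) * t * k * e1 - (t + a ^ 2) * t * ((x - 1) * (x - k)) * hLv
      + (t + a ^ 2) * a ^ 2 * c ^ 2 * (m - t) * ((x - 1) * (x - k)) * hk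
  refine ⟨![v 0 + k * u₀, v 1 + k * u₁, v 2 + k * u₂], ?_, ?_, ?_⟩
  · have e1 := hmline k
    rw [pencilEq, hline] at e1
    simpa [hm0'.ne'] using e1
  · rw [hline]; ring
  · have hw : (c ^ 2 - t) * u₂ ≠ 0 := by
      intro h0
      have h1 : u₂ = 0 := by simpa [hβ0] using h0
      rw [h1, zero_pow two_ne_zero, mul_zero, add_zero] at hcone
      rw [h1, zero_pow two_ne_zero, add_zero] at hN
      have : 0 < c ^ 2 * (m + a ^ 2) * (u₀ ^ 2 + u₁ ^ 2) := by rw [← hN]; positivity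
      linarith
    -- Where the line crosses the plane, `hT` gives the sign opposite to that at `v`. The crossing
    -- parameter is therefore strictly between `1` and `k`.
    obtain ⟨x, hx⟩ : ∃ x, (c ^ 2 - t) * (v 2 + x * u₂) - c ^ 2 * p 2 = 0 := by
      refine ⟨(c ^ 2 * p 2 - (c ^ 2 - t) * v 2) / ((c ^ 2 - t) * u₂), ?_⟩
      have : u₂ ≠ 0 := right_ne_zero_of_mul hw
      field_simp
      ring
    have h1 := hT ![v 0 + x * u₀, v 1 + x * u₁, v 2 + x * u₂] (by simpa using hx)
    have h2 := mul_pos h1 hk0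
    rw [hpline] at h2
    have h3 : (x - 1) * (x - k) < 0 := neg_of_mul_pos_right h2 hTv.le
    have e1 : ((c ^ 2 - t) * q 2 - c ^ 2 * p 2) *
        ((c ^ 2 - t) * (v 2 + k * u₂) - c ^ 2 * p 2) =
        ((c ^ 2 - t) * u₂) ^ 2 * ((x - 1) * (x - k)) := by
      rw [hq2']
      have : c ^ 2 * p 2 = (c ^ 2 - t) * (v 2 + x * u₂) := by linarith
      rw [this]; ring
    have : 0 < ((c ^ 2 - t) * u₂) ^ 2 := by positivity
    simp only [Matrix.cons_val]
    rw [e1]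
    exact mul_neg_of_pos_of_neg this h3

/-- The pencil vertex at the root `m` and the parameter `t` are placed so that the intersection curve
avoids a plane, while its points are exchanged in pairs by projection from the vertex. -/
lemma not_isPreconnected_inter {a c r : ℝ} (ha : 0 < a) (hc : 0 < c) {p : Fin 3 → ℝ}
    {t m : ℝ} (hm : c ^ 2 ≤ m) (hm0 : reducedCubic a c r p m = 0)
    (hαβ : (t + a ^ 2) * (c ^ 2 - t) < 0) (hβ : 0 < (c ^ 2 - t) * reducedCubic a c r p t)
    (hαm : 0 < (t + a ^ 2) * (t - m)) (hH : c ^ 2 < m → hypEq a c (pencilVertex a c p m) < 0)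
    (hne : ∃ q, hypEq a c q = 0 ∧ sphereEq r p q = 0) :
    ¬ IsPreconnected {q | hypEq a c q = 0 ∧ sphereEq r p q = 0} := by
  intro hcon
  have hc2 : 0 < c ^ 2 := by positivity
  have ha2 : 0 < a ^ 2 := by positivity
  have hβ0 : c ^ 2 - t ≠ 0 := by rintro h0; simp [h0] at hβ
  have hα0 : t + a ^ 2 ≠ 0 := by rintro h0; simp [h0] at hαβ
  -- the pencil member is negative where it meets the plane, up to sign
  have hT : ∀ x : Fin 3 → ℝ, (c ^ 2 - t) * x 2 - c ^ 2 * p 2 = 0 →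
      0 < (t + a ^ 2) * pencilEq a c r p t x := by
    intro x hx
    have := mul_pencilEq a c r p t x
    rw [hx] at this
    have h1 : (c ^ 2 - t) ^ 2 * ((t + a ^ 2) * pencilEq a c r p t x) = (c ^ 2 - t) ^ 2 * (c ^ 2 *
      (((t + a ^ 2) * x 0 - a ^ 2 * p 0) ^ 2 + ((t + a ^ 2) * x 1 - a ^ 2 * p 1) ^ 2)) +
        a ^ 2 * c ^ 2 * ((c ^ 2 - t) * reducedCubic a c r p t) := by
      linear_combination (c ^ 2 - t) * this
    have h2 : 0 < (c ^ 2 - t) ^ 2 * ((t + a ^ 2) * pencilEq a c r p t x) := by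
      rw [h1]; positivity
    exact pos_of_mul_pos_right h2 (sq_nonneg _)
  have hT0 : ∀ x, hypEq a c x = 0 → sphereEq r p x = 0 → (c ^ 2 - t) * x 2 - c ^ 2 * p 2 ≠ 0 := by
    intro x h1 h2 h3
    have := hT x h3
    simp [pencilEq, h1, h2] at this
  obtain ⟨q, hq1, hq2⟩ := hne
  suffices h : ∃ q', hypEq a c q' = 0 ∧ sphereEq r p q' = 0 ∧
      ((c ^ 2 - t) * q 2 - c ^ 2 * p 2) * ((c ^ 2 - t) * q' 2 - c ^ 2 * p 2) < 0 by
    obtain ⟨q', h1, h2, h3⟩ := h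
    have hcont : Continuous fun x : Fin 3 → ℝ => (c ^ 2 - t) * x 2 - c ^ 2 * p 2 := by fun_prop
    have := hcon.image _ hcont.continuousOn
    have h0 : (0 : ℝ) ∈ (fun x : Fin 3 → ℝ => (c ^ 2 - t) * x 2 - c ^ 2 * p 2) ''
        {q | hypEq a c q = 0 ∧ sphereEq r p q = 0} := by
      rcases mul_neg_iff.1 h3 with ⟨h4, h5⟩ | ⟨h4, h5⟩
      · exact this.Icc_subset ⟨q', ⟨h1, h2⟩, rfl⟩ ⟨q, ⟨hq1, hq2⟩, rfl⟩ ⟨h5.le, h4.le⟩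
      · exact this.Icc_subset ⟨q, ⟨hq1, hq2⟩, rfl⟩ ⟨q', ⟨h1, h2⟩, rfl⟩ ⟨h4.le, h5.le⟩
    obtain ⟨x, ⟨hx1, hx2⟩, hx⟩ := h0
    exact hT0 x hx1 hx2 hx
  -- For `m = c²` the cone becomes a vertical cylinder and the centre has height `0`; reflection in
  -- `z = 0` replaces the projection from the vertex.
  rcases hm.eq_or_lt with rfl | hm'
  · have p2 : p 2 = 0 := by
      rw [reducedCubic_sq] at hm0
      have : p 2 ^ 2 * (c ^ 2 * (a ^ 2 + c ^ 2)) = 0 := by linarith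
      have h' : c ^ 2 * (a ^ 2 + c ^ 2) ≠ 0 := by positivity
      simpa [h'] using this
    have hqz := hT0 q hq1 hq2
    refine ⟨![q 0, q 1, -q 2], by simpa [hypEq] using hq1, ?_, ?_⟩
    · simp only [sphereEq, p2] at hq2
      simp [sphereEq, p2]; linarith
    · simp only [p2, mul_zero, sub_zero] at hqz ⊢
      have : 0 < ((c ^ 2 - t) * q 2) ^ 2 := by positivity
      simp only [Matrix.cons_val]
      linarith
  exact exists_neg_partner ha hc hm' hm0 hβ0 hαm (hH hm') hT hq1 hq2

/-- The separating member is the midpoint of `l₂, l₃` with apex at `l₄`, or the midpoint of `l₃, l₄`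
with apex at `l₂`. Each apex root is extreme, so the cubic has positive derivative there; beyond
`c²` this makes the apex interior to the hyperboloid. -/
lemma not_isPreconnected_of_roots {a c r : ℝ} (ha : 0 < a) (hc : 0 < c) {p : Fin 3 → ℝ}
    {l₂ l₃ l₄ : ℝ} (h : ∀ t, reducedCubic a c r p t = (t - l₂) * (t - l₃) * (t - l₄))
    (h4 : c ^ 2 ≤ l₄) (hcase : (l₂ < l₃ ∧ l₃ ≤ -a ^ 2) ∨ (c ^ 2 ≤ l₂ ∧ l₂ < l₃ ∧ l₃ < l₄))
    (hne : ∃ q, hypEq a c q = 0 ∧ sphereEq r p q = 0) :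
    ¬ IsPreconnected {q | hypEq a c q = 0 ∧ sphereEq r p q = 0} := by
  have hc2 : 0 < c ^ 2 := by positivity
  have ha2 : 0 < a ^ 2 := by positivity
  have hac : 0 < a ^ 2 * c ^ 2 := by positivity
  have hvertex : ∀ {x y z : ℝ}, (∀ t, reducedCubic a c r p t = (t - x) * (t - y) * (t - z)) →
      0 < (x - y) * (x - z) → c ^ 2 < x → hypEq a c (pencilVertex a c p x) < 0 := by
    intro x y z hxyz hpos hx
    have := hypEq_pencilVertex hxyz (by linarith) (by linarith)
    have h1 : (x + a ^ 2) * (c ^ 2 - x) < 0 := mul_neg_of_pos_of_neg (by linarith) (by linarith)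
    have h2 : 0 < a ^ 2 * c ^ 2 * ((x - y) * (x - z)) := mul_pos hac hpos
    rw [← this] at h2
    exact neg_of_mul_pos_right h2 h1.le
  rcases hcase with ⟨h23, h3⟩ | ⟨h2, h23, h34⟩
  · refine not_isPreconnected_inter (t := (l₂ + l₃) / 2) ha hc h4 (by rw [h]; ring) ?_ ?_ ?_ ?_ hne
    · exact mul_neg_of_neg_of_pos (by linarith) (by linarith)
    · rw [h]
      exact mul_pos (by linarith)
        (mul_pos_of_neg_of_neg (mul_neg_of_pos_of_neg (by linarith) (by linarith)) (by linarith))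
    · exact mul_pos_of_neg_of_neg (by linarith) (by linarith)
    · exact hvertex (x := l₄) (y := l₂) (z := l₃) (fun t => by rw [h]; ring)
        (mul_pos (by linarith) (by linarith))
  · refine not_isPreconnected_inter (t := (l₃ + l₄) / 2) ha hc h2 (by rw [h]; ring) ?_ ?_ ?_ ?_ hne
    · exact mul_neg_of_pos_of_neg (by linarith) (by linarith)
    · rw [h]
      exact mul_pos_of_neg_of_neg (by linarith)
        (mul_neg_of_pos_of_neg (mul_pos (by linarith) (by linarith)) (by linarith))
    · exact mul_pos (by linarith) (by linarith)
    · exact hvertex h (mul_pos_of_neg_of_neg (by linarith) (by linarith))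

/-! ### Quartics and their resolvent -/

/-- A quartic with positive leading coefficient that is positive at a point between two of its roots
has four real roots. -/
lemma exists_quartic_factorization {n₄ n₃ n₂ n₁ n₀ r₁ r₄ z : ℝ} (hn : 0 < n₄)
    (h1 : n₄ * r₁ ^ 4 + n₃ * r₁ ^ 3 + n₂ * r₁ ^ 2 + n₁ * r₁ + n₀ = 0)
    (h4 : n₄ * r₄ ^ 4 + n₃ * r₄ ^ 3 + n₂ * r₄ ^ 2 + n₁ * r₄ + n₀ = 0) (h1z : r₁ < z) (h4z : z < r₄)
    (hz : 0 < n₄ * z ^ 4 + n₃ * z ^ 3 + n₂ * z ^ 2 + n₁ * z + n₀) :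
    ∃ r₂ r₃, r₂ < r₃ ∧ ∀ x, n₄ * x ^ 4 + n₃ * x ^ 3 + n₂ * x ^ 2 + n₁ * x + n₀ =
      n₄ * ((x - r₁) * (x - r₂) * (x - r₃) * (x - r₄)) := by
  obtain ⟨s, hs⟩ : ∃ s, s = n₃ + n₄ * (r₁ + r₄) := ⟨_, rfl⟩
  obtain ⟨m, hm⟩ : ∃ m, m = n₂ + n₃ * (r₁ + r₄) + n₄ * (r₁ + r₄) ^ 2 - n₄ * (r₁ * r₄) := ⟨_, rfl⟩
  have hfac : ∀ x, n₄ * x ^ 4 + n₃ * x ^ 3 + n₂ * x ^ 2 + n₁ * x + n₀ =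
      (x - r₁) * (x - r₄) * (n₄ * x ^ 2 + s * x + m) := by
    intro x
    refine mul_left_cancel₀ (sub_ne_zero.2 (h1z.trans h4z).ne) ?_
    rw [hs, hm]
    linear_combination (x - r₄) * h1 - (x - r₁) * h4
  -- The quadratic quotient is negative at `z`, so its discriminant is positive.
  have hneg : n₄ * z ^ 2 + s * z + m < 0 := by
    rw [hfac] at hz
    exact neg_of_mul_pos_right hz (mul_neg_of_pos_of_neg (by linarith) (by linarith)).le
  have hdisc : 0 < s ^ 2 - 4 * n₄ * m := by
    nlinarith [sq_nonneg (2 * n₄ * z + s), mul_pos_of_neg_of_neg hneg (neg_lt_zero.2 hn)]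
  have hsq := Real.sq_sqrt hdisc.le
  have hpos := Real.sqrt_pos.2 hdisc
  generalize √(s ^ 2 - 4 * n₄ * m) = e at hsq hpos
  refine ⟨(-s - e) / (2 * n₄), (-s + e) / (2 * n₄), by gcongr; linarith, fun x => ?_⟩
  rw [hfac]
  field_simp
  linear_combination (x - r₁) * (x - r₄) * hsq

/-- The resolvent cubic of `(k z² + f z + g)² - A - C z²`, with roots paired as `12|34`. -/
lemma resolvent_eq_zero {k f g A C r₁ r₂ r₃ r₄ : ℝ} (hk : k ≠ 0)
    (h : ∀ z, (k * z ^ 2 + f * z + g) ^ 2 - A - C * z ^ 2 =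
      k ^ 2 * ((z - r₁) * (z - r₂) * (z - r₃) * (z - r₄))) {τ : ℝ}
    (hτ : τ = k * (r₁ * r₂ + r₃ * r₄) - 2 * g) :
    (C + τ * k) * (A + τ * g) - τ ^ 2 * f ^ 2 / 4 + τ ^ 2 / 4 * (C + τ * k) = 0 := by
  have e0 := h 0
  have e1 := h 1
  have e2 := h (-1)
  have e3 := h 2
  have hA : A = g ^ 2 - k ^ 2 * (r₁ * r₂ * r₃ * r₄) := by linear_combination -e0
  have hf : f = -k * (r₁ + r₂ + r₃ + r₄) / 2 := by
    refine mul_left_cancel₀ (mul_ne_zero two_ne_zero hk) ?_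
    linear_combination 1/6 * e3 - 1/2 * e1 - 1/6 * e2 + 1/2 * e0
  have hC : C = f ^ 2 + 2 * k * g - k ^ 2 * (r₁ * r₂ + r₃ * r₄ + (r₁ + r₂) * (r₃ + r₄)) := by
    linear_combination -1/2 * e1 - 1/2 * e2 + e0
  have hg : g * (r₁ + r₂ + r₃ + r₄) = k * (r₁ * r₂ * (r₃ + r₄) + r₃ * r₄ * (r₁ + r₂)) := by
    refine mul_left_cancel₀ hk ?_
    have : 2 * f * g = -k ^ 2 * (r₁ * r₂ * (r₃ + r₄) + r₃ * r₄ * (r₁ + r₂)) := by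
      linear_combination e1 - 1/3 * e2 - 1/6 * e3 - 1/2 * e0
    rw [hf] at this
    linear_combination -this
  have hτe : τ * (r₁ + r₂ + r₃ + r₄) =
      k * ((r₁ * r₂ - r₃ * r₄) * (r₁ + r₂ - (r₃ + r₄))) := by
    rw [hτ]; linear_combination -2 * hg
  -- Ferrari: adding `τ/2` inside the square turns it into the square of the mean of the factors of
  -- `12` and `34`, up to scale. The excess over the quartic is a perfect square whose outer
  -- coefficients are computed here; the claim is that its discriminant vanishes.
  have h1 : C + τ * k = k ^ 2 * (r₁ + r₂ - (r₃ + r₄)) ^ 2 / 4 := by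
    rw [hC, hf, hτ]; ring
  have h2 : A + τ * g + τ ^ 2 / 4 = k ^ 2 * (r₁ * r₂ - r₃ * r₄) ^ 2 / 4 := by
    rw [hA, hτ]; ring
  have h3 : (C + τ * k) * (A + τ * g) - τ ^ 2 * f ^ 2 / 4 + τ ^ 2 / 4 * (C + τ * k) =
      (C + τ * k) * (A + τ * g + τ ^ 2 / 4) - τ ^ 2 * f ^ 2 / 4 := by ring
  rw [h3, h1, h2, hf]
  linear_combination -k ^ 2 / 16 * (τ * (r₁ + r₂ + r₃ + r₄) +
      k * ((r₁ * r₂ - r₃ * r₄) * (r₁ + r₂ - (r₃ + r₄)))) * hτe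

/-- The resolvent of the quartic that describes the projection of the intersection curve to the axis
is the reduced cubic, up to a change of parameter. -/
lemma reducedCubic_eq_zero_of_resolvent {a c r d τ : ℝ} (ha : 0 < a) (hc : 0 < c) (hd : 0 < d)
    {p : Fin 3 → ℝ} (hp : p 0 ^ 2 + p 1 ^ 2 = d ^ 2)
    (h : (a ^ 2 / c ^ 2 + τ * ((1 + a ^ 2 / c ^ 2) / (2 * d))) *
        (a ^ 2 + τ * ((a ^ 2 + d ^ 2 + p 2 ^ 2 - r ^ 2) / (2 * d))) -
      τ ^ 2 * (-p 2 / d) ^ 2 / 4 +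
      τ ^ 2 / 4 * (a ^ 2 / c ^ 2 + τ * ((1 + a ^ 2 / c ^ 2) / (2 * d))) = 0) :
    τ ≠ 0 ∧ reducedCubic a c r p (-a ^ 2 - 2 * d * a ^ 2 / τ) = 0 := by
  have hτ : τ ≠ 0 := by
    rintro rfl
    simp [ha.ne', hc.ne'] at h
  refine ⟨hτ, ?_⟩
  have key : reducedCubic a c r p (-a ^ 2 - 2 * d * a ^ 2 / τ) * τ ^ 3 =
      -(8 * d ^ 3 * a ^ 2 * c ^ 2) *
      ((a ^ 2 / c ^ 2 + τ * ((1 + a ^ 2 / c ^ 2) / (2 * d))) *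
        (a ^ 2 + τ * ((a ^ 2 + d ^ 2 + p 2 ^ 2 - r ^ 2) / (2 * d))) -
      τ ^ 2 * (-p 2 / d) ^ 2 / 4 +
      τ ^ 2 / 4 * (a ^ 2 / c ^ 2 + τ * ((1 + a ^ 2 / c ^ 2) / (2 * d)))) := by
    unfold reducedCubic
    rw [hp]
    field_simp
    ring
  rw [h, mul_zero] at key
  simpa [hτ] using key

/-! ### The intersection curve over the axis -/

section Curve

variable {a c r d : ℝ} {p : Fin 3 → ℝ}

/-- Along the intersection curve, the coordinate in the direction of the centre of the sphere is
this function of the height. -/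
noncomputable def curveRadial (a c r d : ℝ) (p : Fin 3 → ℝ) (z : ℝ) : ℝ :=
  (1 + a ^ 2 / c ^ 2) / (2 * d) * z ^ 2 + -p 2 / d * z +
    (a ^ 2 + d ^ 2 + p 2 ^ 2 - r ^ 2) / (2 * d)

/-- Along the intersection curve, the square of the coordinate transversal to the direction of the
centre of the sphere is this function of the height. -/
noncomputable def curveTransversalSq (a c r d : ℝ) (p : Fin 3 → ℝ) (z : ℝ) : ℝ :=
  a ^ 2 + a ^ 2 / c ^ 2 * z ^ 2 - curveRadial a c r d p z ^ 2

/-- The points of the intersection curve, parametrized by the height. -/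
noncomputable def curvePoint (a c r d : ℝ) (p : Fin 3 → ℝ) (σ z : ℝ) : Fin 3 → ℝ :=
  ![(p 0 * curveRadial a c r d p z - σ * p 1 * √(curveTransversalSq a c r d p z)) / d,
    (p 1 * curveRadial a c r d p z + σ * p 0 * √(curveTransversalSq a c r d p z)) / d, z]

lemma continuous_curveRadial : Continuous (curveRadial a c r d p) := by
  unfold curveRadial; fun_prop

lemma continuous_curveTransversalSq : Continuous (curveTransversalSq a c r d p) := by
  have := continuous_curveRadial (a := a) (c := c) (r := r) (d := d) (p := p)
  unfold curveTransversalSq; fun_prop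

lemma continuous_curvePoint (σ : ℝ) : Continuous (curvePoint a c r d p σ) := by
  have h1 := continuous_curveRadial (a := a) (c := c) (r := r) (d := d) (p := p)
  have h2 := continuous_curveTransversalSq (a := a) (c := c) (r := r) (d := d) (p := p)
  refine continuous_pi fun i => ?_
  fin_cases i <;> simp [curvePoint] <;> fun_prop

lemma curvePoint_mem (hc : 0 < c) (hd : 0 < d) (hp : p 0 ^ 2 + p 1 ^ 2 = d ^ 2) {σ z : ℝ}
    (hσ : σ ^ 2 = 1) (hz : 0 ≤ curveTransversalSq a c r d p z) :
    hypEq a c (curvePoint a c r d p σ z) = 0 ∧ sphereEq r p (curvePoint a c r d p σ z) = 0 := by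
  have hw := Real.sq_sqrt hz
  obtain ⟨w, hw'⟩ : ∃ w, w = √(curveTransversalSq a c r d p z) := ⟨_, rfl⟩
  obtain ⟨u, hu⟩ : ∃ u, u = curveRadial a c r d p z := ⟨_, rfl⟩
  have hu' := hu
  rw [← hw'] at hw
  unfold curvePoint
  rw [curveTransversalSq] at hw
  rw [← hw', ← hu]
  rw [← hu] at hw
  unfold curveRadial at hu'
  have hn : ((p 0 * u - σ * p 1 * w) / d) ^ 2 + ((p 1 * u + σ * p 0 * w) / d) ^ 2 =
      u ^ 2 + w ^ 2 := by
    field_simp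
    linear_combination (u ^ 2 + σ ^ 2 * w ^ 2) * hp + d ^ 2 * w ^ 2 * hσ
  have hpu : p 0 * ((p 0 * u - σ * p 1 * w) / d) + p 1 * ((p 1 * u + σ * p 0 * w) / d) =
      d * u := by
    field_simp
    linear_combination u * hp
  have hw2 : c ^ 2 * (u ^ 2 + w ^ 2) = a ^ 2 * c ^ 2 + a ^ 2 * z ^ 2 := by
    rw [hw]; field_simp; ring
  have hdu : 2 * (d * u) = (1 + a ^ 2 / c ^ 2) * z ^ 2 - 2 * p 2 * z +
      (a ^ 2 + d ^ 2 + p 2 ^ 2 - r ^ 2) := by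
    rw [hu']; field_simp; ring
  constructor
  · simp only [hypEq, Matrix.cons_val]
    rw [hn]
    linear_combination hw2
  · simp only [sphereEq, Matrix.cons_val]
    have : u ^ 2 + w ^ 2 = a ^ 2 + a ^ 2 / c ^ 2 * z ^ 2 := by rw [hw]; ring
    linear_combination hn - 2 * hpu + hp - hdu + this

/-- In horizontal coordinates `u` towards the centre and `w` across, the difference of the equations
gives `u` and the hyperboloid gives `w²`; the sign of `w` selects the branch. -/
lemma eq_curvePoint (hc : 0 < c) (hd : 0 < d) (hp : p 0 ^ 2 + p 1 ^ 2 = d ^ 2) {q : Fin 3 → ℝ}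
    (h1 : hypEq a c q = 0) (h2 : sphereEq r p q = 0) :
    0 ≤ curveTransversalSq a c r d p (q 2) ∧
      (q = curvePoint a c r d p 1 (q 2) ∨ q = curvePoint a c r d p (-1) (q 2)) := by
  obtain ⟨u, hu⟩ : ∃ u, u = (p 0 * q 0 + p 1 * q 1) / d := ⟨_, rfl⟩
  obtain ⟨w, hw⟩ : ∃ w, w = (p 0 * q 1 - p 1 * q 0) / d := ⟨_, rfl⟩
  have hq0 : q 0 = (p 0 * u - p 1 * w) / d := by
    rw [hu, hw]; field_simp; linear_combination -q 0 * hp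
  have hq1 : q 1 = (p 1 * u + p 0 * w) / d := by
    rw [hu, hw]; field_simp; linear_combination -q 1 * hp
  have hρ := (hypEq_eq_iff hc q).1 h1
  have hn : u ^ 2 + w ^ 2 = q 0 ^ 2 + q 1 ^ 2 := by
    rw [hu, hw]; field_simp; linear_combination (q 0 ^ 2 + q 1 ^ 2) * hp
  have hru : curveRadial a c r d p (q 2) = u := by
    unfold curveRadial
    unfold sphereEq at h2
    have hdu : d * u = p 0 * q 0 + p 1 * q 1 := by rw [hu]; field_simp
    field_simp at hρ ⊢
    linear_combination -hρ + 2 * c ^ 2 * (-hdu) + c ^ 2 * h2 - c ^ 2 * hp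
  have hψ : curveTransversalSq a c r d p (q 2) = w ^ 2 := by
    rw [curveTransversalSq, hru]
    linear_combination -hn - hρ
  refine ⟨hψ ▸ sq_nonneg w, ?_⟩
  rcases le_total 0 w with h0 | h0
  · left
    ext i
    fin_cases i <;> simp [curvePoint, hru, hψ, Real.sqrt_sq h0, ← hq0, ← hq1]
  · right
    ext i
    fin_cases i <;> simp [curvePoint, hru, hψ, Real.sqrt_sq_eq_abs, abs_of_nonpos h0, ← hq0, ← hq1]

/-- If the reduced cubic has only one real root, then the projection of the intersection curve to the
axis is an interval. -/
lemma ordConnected_curveTransversalSq (ha : 0 < a) (hc : 0 < c) (hd : 0 < d)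
    (hp : p 0 ^ 2 + p 1 ^ 2 = d ^ 2)
    (huniq : ∀ x y, reducedCubic a c r p x = 0 → reducedCubic a c r p y = 0 → x = y) :
    Set.OrdConnected {z | 0 ≤ curveTransversalSq a c r d p z} := by
  have hbound : ∀ z, 0 ≤ curveTransversalSq a c r d p z → (z - p 2) ^ 2 ≤ r ^ 2 := by
    intro z hz
    have := (curvePoint_mem hc hd hp (σ := 1) (by norm_num) hz).2
    simp only [sphereEq] at this
    have e : curvePoint a c r d p 1 z 2 = z := by simp [curvePoint]
    rw [e] at this
    nlinarith [sq_nonneg (curvePoint a c r d p 1 z 0 - p 0),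
      sq_nonneg (curvePoint a c r d p 1 z 1 - p 1)]
  have hcont := continuous_curveTransversalSq (a := a) (c := c) (r := r) (d := d) (p := p)
  refine ⟨fun z₁ h1 z₃ h3 z₂ hz => ?_⟩
  by_contra hneg
  simp only [Set.mem_ofPred_eq, not_le] at hneg h1 h3
  have hfar : ∀ z, r ^ 2 < (z - p 2) ^ 2 → curveTransversalSq a c r d p z ≤ 0 := by
    intro z hz
    by_contra! h0
    exact absurd (hbound z h0.le) (not_le.2 hz)
  obtain ⟨M, hM1, hM2, hM3, hM4⟩ : ∃ M, r ^ 2 < (M - p 2) ^ 2 ∧ r ^ 2 < (-M - p 2) ^ 2 ∧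
      z₃ ≤ M ∧ -M ≤ z₁ := by
    refine ⟨|r| + |p 2| + |z₁| + |z₃| + 1, ?_, ?_, ?_, ?_⟩
    · rw [← sq_abs r]
      have := le_abs_self (p 2)
      have := abs_nonneg z₁
      have := abs_nonneg z₃
      exact pow_lt_pow_left₀ (by linarith) (abs_nonneg r) two_ne_zero
    · rw [← sq_abs r, ← neg_sq (-(|r| + |p 2| + |z₁| + |z₃| + 1) - p 2)]
      have := neg_abs_le (p 2)
      have := abs_nonneg z₁
      have := abs_nonneg z₃
      exact pow_lt_pow_left₀ (by linarith) (abs_nonneg r) two_ne_zero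
    · linarith [le_abs_self z₃, abs_nonneg r, abs_nonneg (p 2), abs_nonneg z₁]
    · linarith [neg_abs_le z₁, abs_nonneg r, abs_nonneg (p 2), abs_nonneg z₃]
  -- Beyond the height range of the sphere the quartic is nonpositive, so it has zeros on both outer
  -- sides of the supposed gap.
  obtain ⟨r₁, ⟨-, hr1⟩, hr1'⟩ := intermediate_value_Icc hM4 hcont.continuousOn
    (Set.mem_Icc.2 ⟨hfar _ hM2, h1⟩)
  obtain ⟨r₄, ⟨hr4, -⟩, hr4'⟩ := intermediate_value_Icc' hM3 hcont.continuousOn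
    (Set.mem_Icc.2 ⟨hfar _ hM1, h3⟩)
  have hz1 : z₁ < z₂ := lt_of_le_of_ne hz.1 (by rintro rfl; linarith)
  have hz3 : z₂ < z₃ := lt_of_le_of_ne hz.2 (by rintro rfl; linarith)
  obtain ⟨k, hk⟩ : ∃ k, k = (1 + a ^ 2 / c ^ 2) / (2 * d) := ⟨_, rfl⟩
  obtain ⟨f, hf⟩ : ∃ f, f = -p 2 / d := ⟨_, rfl⟩
  obtain ⟨g, hg⟩ : ∃ g, g = (a ^ 2 + d ^ 2 + p 2 ^ 2 - r ^ 2) / (2 * d) := ⟨_, rfl⟩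
  have hk0 : 0 < k := by rw [hk]; positivity
  have hψ : ∀ z, curveTransversalSq a c r d p z =
      -(k ^ 2 * z ^ 4 + 2 * k * f * z ^ 3 + (f ^ 2 + 2 * k * g - a ^ 2 / c ^ 2) * z ^ 2 +
        2 * f * g * z + (g ^ 2 - a ^ 2)) := by
    intro z
    rw [curveTransversalSq, curveRadial, ← hk, ← hf, ← hg]; ring
  rw [hψ] at hr1' hr4' hneg
  obtain ⟨r₂, r₃, h23, hfac⟩ := exists_quartic_factorization (pow_pos hk0 2)
    (neg_eq_zero.1 hr1') (neg_eq_zero.1 hr4') (hr1.trans_lt hz1) (hz3.trans_le hr4)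
    (neg_lt_zero.1 hneg)
  have hres : ∀ z, (k * z ^ 2 + f * z + g) ^ 2 - a ^ 2 - a ^ 2 / c ^ 2 * z ^ 2 =
      k ^ 2 * ((z - r₁) * (z - r₂) * (z - r₃) * (z - r₄)) := by
    intro z; rw [← hfac]; ring
  -- The pairings `12|34` and `13|24` give resolvent roots that differ by `k(r₄ - r₁)(r₃ - r₂) ≠ 0`.
  have e1 := resolvent_eq_zero hk0.ne' hres rfl
  have e2 := resolvent_eq_zero (r₁ := r₁) (r₂ := r₃) (r₃ := r₂) (r₄ := r₄) hk0.ne' (fun z => by rw [hres z]; ring) rfl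
  generalize hτ₁ : k * (r₁ * r₂ + r₃ * r₄) - 2 * g = τ₁ at e1
  generalize hτ₂ : k * (r₁ * r₃ + r₂ * r₄) - 2 * g = τ₂ at e2
  rw [hk, hf, hg] at e1 e2
  obtain ⟨n1, f1⟩ := reducedCubic_eq_zero_of_resolvent ha hc hd hp e1
  obtain ⟨n2, f2⟩ := reducedCubic_eq_zero_of_resolvent ha hc hd hp e2
  have heq := huniq _ _ f1 f2
  have hτ : τ₁ = τ₂ := by
    have e := sub_right_injective heq
    rw [div_eq_div_iff n1 n2] at e
    exact (mul_left_cancel₀ (by positivity) e).symm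
  have : k * ((r₄ - r₁) * (r₃ - r₂)) = 0 := by linear_combination hτ₁ - hτ₂ + hτ
  have h' : 0 < k * ((r₄ - r₁) * (r₃ - r₂)) :=
    mul_pos hk0 (mul_pos (by linarith) (by linarith))
  exact h'.ne' this

/-- Both branches are continuous images of an interval, and they meet where the transversal
coordinate vanishes. -/
lemma isPreconnected_inter_of_unique_root (ha : 0 < a) (hc : 0 < c)
    (hp0 : p 0 ^ 2 + p 1 ^ 2 ≠ 0)
    (huniq : ∀ x y, reducedCubic a c r p x = 0 → reducedCubic a c r p y = 0 → x = y) :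
    IsPreconnected {q | hypEq a c q = 0 ∧ sphereEq r p q = 0} := by
  have hpos : 0 < p 0 ^ 2 + p 1 ^ 2 := lt_of_le_of_ne (by positivity) hp0.symm
  obtain ⟨d, hd, hp⟩ : ∃ d, 0 < d ∧ p 0 ^ 2 + p 1 ^ 2 = d ^ 2 :=
    ⟨_, Real.sqrt_pos.2 hpos, (Real.sq_sqrt hpos.le).symm⟩
  have hZ := (ordConnected_curveTransversalSq ha hc hd hp huniq).isPreconnected
  have hcont := continuous_curveTransversalSq (a := a) (c := c) (r := r) (d := d) (p := p)
  have hset : {q | hypEq a c q = 0 ∧ sphereEq r p q = 0} =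
      curvePoint a c r d p 1 '' {z | 0 ≤ curveTransversalSq a c r d p z} ∪
        curvePoint a c r d p (-1) '' {z | 0 ≤ curveTransversalSq a c r d p z} := by
    ext q
    constructor
    · rintro ⟨h1, h2⟩
      obtain ⟨h0, h | h⟩ := eq_curvePoint hc hd hp h1 h2
      · exact Or.inl ⟨q 2, h0, h.symm⟩
      · exact Or.inr ⟨q 2, h0, h.symm⟩
    · rintro (⟨z, hz, rfl⟩ | ⟨z, hz, rfl⟩)
      · exact curvePoint_mem hc hd hp (by norm_num) hz
      · exact curvePoint_mem hc hd hp (by norm_num) hz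
  rcases Set.eq_empty_or_nonempty {z | 0 ≤ curveTransversalSq a c r d p z} with he | ⟨z, hz⟩
  · rw [hset, he]; simpa using isPreconnected_empty
  obtain ⟨z₀, hz₀⟩ : ∃ z₀, curveTransversalSq a c r d p z₀ = 0 := by
    have hlow : curveTransversalSq a c r d p (p 2 - |r| - 1) ≤ 0 := by
      by_contra! h0
      have := (curvePoint_mem hc hd hp (σ := 1) (by norm_num) h0.le).2
      simp only [sphereEq, curvePoint, Matrix.cons_val] at this
      have h1 : (p 2 - |r| - 1 - p 2) ^ 2 = r ^ 2 + 2 * |r| + 1 := by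
        rw [← sq_abs r]; ring
      rw [h1] at this
      nlinarith [abs_nonneg r, sq_nonneg ((p 0 * curveRadial a c r d p (p 2 - |r| - 1) - 1 * p 1 * √(curveTransversalSq a c r d p (p 2 - |r| - 1))) / d - p 0)]
    exact mem_range_of_exists_le_of_exists_ge hcont ⟨_, hlow⟩ ⟨z, hz⟩
  have heq : curvePoint a c r d p 1 z₀ = curvePoint a c r d p (-1) z₀ := by
    simp [curvePoint, hz₀]
  rw [hset]
  refine IsPreconnected.union (curvePoint a c r d p 1 z₀) ⟨z₀, hz₀.ge, rfl⟩
    ⟨z₀, hz₀.ge, heq.symm⟩ (hZ.image _ (continuous_curvePoint 1).continuousOn)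
    (hZ.image _ (continuous_curvePoint (-1)).continuousOn)

end Curve

/-! ### Type C, small spheres and the theorem -/

lemma isConnected_inter_of_complex_roots {a c r : ℝ} (ha : 0 < a) (hc : 0 < c) (hr : 0 < r)
    {p : Fin 3 → ℝ} {x y l : ℝ}
    (h : ∀ t, reducedCubic a c r p t = ((t - x) ^ 2 + y ^ 2) * (t - l)) (hy : y ≠ 0) (hl : 0 < l) :
    (∃ q, hypEq a c q = 0 ∧ sphereEq r p q = 0) ∧ (¬ ∃ q t, TangentWith a c r p t q) ∧
      IsPreconnected {q | hypEq a c q = 0 ∧ sphereEq r p q = 0} := by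
  have ha2 : 0 < a ^ 2 := by positivity
  have hquad : ∀ t, 0 < (t - x) ^ 2 + y ^ 2 := fun t => by positivity
  have hroot : ∀ t, reducedCubic a c r p t = 0 → t = l := by
    intro t ht
    rw [h, mul_eq_zero] at ht
    exact sub_eq_zero.1 (ht.resolve_left (hquad t).ne')
  have hneg : ∀ t, t < l → reducedCubic a c r p t < 0 := by
    intro t ht
    rw [h]
    exact mul_neg_of_pos_of_neg (hquad t) (by linarith)
  have hdistinct : ∀ u v w : ℝ, (∀ t, reducedCubic a c r p t = (t - u) * (t - v) * (t - w)) →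
      u = l ∧ v = l ∧ w = l := by
    intro u v w huvw
    exact ⟨hroot u (by rw [huvw]; ring), hroot v (by rw [huvw]; ring), hroot w (by rw [huvw]; ring)⟩
  refine ⟨?_, ?_, ?_⟩
  -- Without contact `hypEq` has constant sign on the connected sphere, which would give two
  -- distinct real roots.
  · by_contra! hno
    have hsign : (∀ q, sphereEq r p q = 0 → hypEq a c q < 0) ∨
        ∀ q, sphereEq r p q = 0 → 0 < hypEq a c q := by
      by_contra! hcon
      obtain ⟨⟨q₁, h1, h1'⟩, q₂, h2, h2'⟩ := hcon
      have h1'' := lt_of_le_of_ne h1' fun h0 => hno q₁ h0.symm h1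
      have h2'' := lt_of_le_of_ne h2' fun h0 => hno q₂ h0 h2
      obtain ⟨q, -, -, hq, -, hq', -⟩ :=
        exists_two_zeros hr (continuous_hypEq a c) h2 h1 h2'' h1''
      exact hno q hq' hq
    rcases hsign with hs | hs
    · obtain ⟨u, v, w, huvw, -, h23, -⟩ := (exists_pos_neg_iff ha hc hr p).1
        ((forall_hypEq_neg_iff ha hc hr).1 hs)
      obtain ⟨rfl, rfl, rfl⟩ := hdistinct u v w huvw
      exact h23.false
    · obtain ⟨u, v, w, huvw, -, h23, -⟩ := (exists_pos_pos_iff ha hc hr p).1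
        ((forall_hypEq_pos_iff ha hc hr).1 hs)
      obtain ⟨rfl, rfl, rfl⟩ := hdistinct u v w huvw
      exact h23.false
  · rintro ⟨q, t, hT⟩
    have hT' := hT.reducedCubic_eq ha hc
    obtain ⟨rfl, -, h3⟩ := hdistinct _ _ _ hT'
    have e := hT' (t + 1)
    rw [h3, h] at e
    have e' := hT' (t - 1)
    rw [h3, h] at e'
    nlinarith [sq_nonneg (t - x), sq_pos_of_ne_zero hy]
  · refine isPreconnected_inter_of_unique_root ha hc ?_ fun u v hu hv => by
      rw [hroot u hu, hroot v hv]
    -- A centre on the axis would make `-a²` a root, but the only real root is positive.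
    intro h0
    have := hneg (-a ^ 2) (by linarith)
    rw [reducedCubic_neg_sq, h0] at this
    simp at this

/-- Contact without tangency, with real roots, is possible only in the two special positions of the
roots. -/
lemma complex_roots_of_contact {a c r : ℝ} (ha : 0 < a) (hc : 0 < c) (hr : 0 < r) {p : Fin 3 → ℝ}
    (hne : ∃ q, hypEq a c q = 0 ∧ sphereEq r p q = 0) (hT : ¬ ∃ q t, TangentWith a c r p t q)
    (hsp : ∀ l₂ l₃ l₄ : ℝ, (∀ t, reducedCubic a c r p t = (t - l₂) * (t - l₃) * (t - l₄)) →
      c ^ 2 ≤ l₄ → ¬ ((l₂ < l₃ ∧ l₃ ≤ -a ^ 2) ∨ (c ^ 2 ≤ l₂ ∧ l₂ < l₃ ∧ l₃ < l₄))) :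
    ∃ x y l, (∀ t, reducedCubic a c r p t = ((t - x) ^ 2 + y ^ 2) * (t - l)) ∧ y ≠ 0 ∧ 0 < l := by
  have hc2 : 0 < c ^ 2 := by positivity
  rcases roots_dichotomy a c r p with ⟨x, y, l, h, hy, hl⟩ | ⟨l₂, l₃, l₄, h, h23, h34, h4⟩
  · exact ⟨x, y, l, h, hy, by linarith⟩
  · rcases real_roots_cases ha hc hr h h23 h34 h4 with h' | h' | h'
    · exact absurd hne h'
    · exact absurd h' hT
    · exact absurd h' (hsp l₂ l₃ l₄ h h4)

lemma exists_hasRoots_complex_iff {a c r : ℝ} (ha : 0 < a) (hc : 0 < c) (p : Fin 3 → ℝ) :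
    (∃ (l₂ l₃ : ℂ) (l₄ : ℝ), HasRoots a c r p l₂ l₃ l₄ ∧
        l₂ = (starRingEnd ℂ) l₃ ∧ l₂.im ≠ 0 ∧ 0 < l₄) ↔
      ∃ x y l, (∀ t, reducedCubic a c r p t = ((t - x) ^ 2 + y ^ 2) * (t - l)) ∧ y ≠ 0 ∧ 0 < l := by
  constructor
  · rintro ⟨_, l₃, l₄, h, rfl, him, h4⟩
    rw [hasRoots_conj_iff ha hc] at h
    exact ⟨l₃.re, l₃.im, l₄, h, by simpa using him, h4⟩
  · rintro ⟨x, y, l, h, hy, hl⟩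
    refine ⟨_, ⟨x, y⟩, l, (hasRoots_conj_iff ha hc p _ _).2 h, rfl, by simpa using hy, hl⟩

/-- A double root of the reduced cubic is bounded by `a r` if the third root is at least `c²`. -/
lemma abs_le_of_double_root {a c r : ℝ} (ha : 0 < a) (hc : 0 < c) (hr : 0 < r) {p : Fin 3 → ℝ}
    {t l : ℝ} (h : ∀ x, reducedCubic a c r p x = (x - t) * (x - t) * (x - l))
    (hl : c ^ 2 ≤ l) : |t| ≤ a * r := by
  have hprod := mul_roots_eq h
  have hc2 : 0 < c ^ 2 := by positivity
  refine abs_le_of_sq_le_sq ?_ (by positivity)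
  have h1 : t ^ 2 * c ^ 2 ≤ t ^ 2 * l := mul_le_mul_of_nonneg_left hl (sq_nonneg t)
  refine le_of_mul_le_mul_right ?_ hc2
  linarith

/-- For a small sphere, a tangency belongs to a pencil member with both diagonal entries positive. -/
lemma TangentWith.mem_of_small {a c r : ℝ} (ha : 0 < a) (hc : 0 < c) (hr : 0 < r) (hra : r < a)
    (harc : a * r < c ^ 2) {p : Fin 3 → ℝ} {t : ℝ} {q : Fin 3 → ℝ}
    (hT : TangentWith a c r p t q) :
    ∃ l, (∀ x, reducedCubic a c r p x = (x - t) * (x - t) * (x - l)) ∧ c ^ 2 ≤ l ∧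
      -a ^ 2 < t ∧ t < c ^ 2 ∧ t ≠ 0 := by
  obtain ⟨l, hl, h⟩ := hT.third_root_ge ha hc
  have habs := abs_le_of_double_root ha hc hr h hl
  have h1 := abs_le.1 habs
  have h2 : a * r < a ^ 2 := by nlinarith
  exact ⟨l, h, hl, by linarith, by linarith, hT.ne_zero ha hc hr⟩

lemma SimplyTangent.areTangent {M N : Matrix (Fin 4) (Fin 4) ℝ} (h : SimplyTangent M N) :
    AreTangent M N :=
  let ⟨q, hq, _⟩ := h
  ⟨q, hq⟩

theorem theorem6 (a c r : ℝ) (p : Fin 3 → ℝ) (ha : 0 < a) (hc : 0 < c) (hr : 0 < r) :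
    (TypeI a c r p ↔
      ∃ l₂ l₃ l₄ : ℝ, HasRoots a c r p l₂ l₃ l₄ ∧
        -a ^ 2 ≤ l₂ ∧ l₂ < l₃ ∧ l₃ < 0 ∧ 0 < l₄) ∧
    (TypeE a c r p ↔
      ∃ l₂ l₃ l₄ : ℝ, HasRoots a c r p l₂ l₃ l₄ ∧
        0 < l₂ ∧ l₂ < l₃ ∧ l₃ ≤ c ^ 2 ∧ c ^ 2 ≤ l₄) ∧
    (TypeTI a c r p ↔
      ∃ l₂ l₃ l₄ : ℝ, HasRoots a c r p l₂ l₃ l₄ ∧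
        -a ^ 2 < l₂ ∧ l₂ = l₃ ∧ l₃ < 0 ∧ 0 < l₄) ∧
    (TypeTE a c r p ↔
      ∃ l₂ l₃ l₄ : ℝ, HasRoots a c r p l₂ l₃ l₄ ∧
        ((0 < l₂ ∧ l₂ = l₃ ∧ l₃ < l₄ ∧ l₃ < c ^ 2) ∨ (l₂ = c ^ 2 ∧ l₃ = c ^ 2 ∧ l₄ = c ^ 2))) ∧
    (TypeC a c r p ↔
      ∃ (l₂ l₃ : ℂ) (l₄ : ℝ), HasRoots a c r p l₂ l₃ l₄ ∧
        l₂ = (starRingEnd ℂ) l₃ ∧ l₂.im ≠ 0 ∧ 0 < l₄) ∧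
    (r < a → a * r < c ^ 2 →
      ((AreTangent (hyperboloidMatrix a c) (sphereMatrix p r) ∧
          IsInteriorPoint (hyperboloidMatrix a c) p ↔
        ∃ l₂ l₃ l₄ : ℝ, HasRoots a c r p l₂ l₃ l₄ ∧
          -a ^ 2 < l₂ ∧ l₂ = l₃ ∧ l₃ < 0 ∧ 0 < l₄) ∧
      (AreTangent (hyperboloidMatrix a c) (sphereMatrix p r) ∧
          IsExteriorPoint (hyperboloidMatrix a c) p ↔
        ∃ l₂ l₃ l₄ : ℝ, HasRoots a c r p l₂ l₃ l₄ ∧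
          0 < l₂ ∧ l₂ = l₃ ∧ l₃ < l₄) ∧
      (InContact (hyperboloidMatrix a c) (sphereMatrix p r) ∧
          ¬ AreTangent (hyperboloidMatrix a c) (sphereMatrix p r) ↔
        ∃ (l₂ l₃ : ℂ) (l₄ : ℝ), HasRoots a c r p l₂ l₃ l₄ ∧
          l₂ = (starRingEnd ℂ) l₃ ∧ l₂.im ≠ 0 ∧ 0 < l₄))) := by
  have ha2 : 0 < a ^ 2 := by positivity
  have hc2 : 0 < c ^ 2 := by positivity
  have hTI : TypeTI a c r p ↔ ∃ l₂ l₃ l₄ : ℝ, HasRoots a c r p l₂ l₃ l₄ ∧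
      -a ^ 2 < l₂ ∧ l₂ = l₃ ∧ l₃ < 0 ∧ 0 < l₄ := by
    rw [typeTI_iff_roots ha hc hr]
    simp only [hasRoots_ofReal_iff ha hc]
    constructor
    · rintro ⟨t, l, h, h1, h2, h3⟩
      exact ⟨t, t, l, h, h1, rfl, h2, h3⟩
    · rintro ⟨t, _, l, h, h1, rfl, h2, h3⟩
      exact ⟨t, l, h, h1, h2, h3⟩
  have hTE : TypeTE a c r p ↔ ∃ l₂ l₃ l₄ : ℝ, HasRoots a c r p l₂ l₃ l₄ ∧
      ((0 < l₂ ∧ l₂ = l₃ ∧ l₃ < l₄ ∧ l₃ < c ^ 2) ∨ (l₂ = c ^ 2 ∧ l₃ = c ^ 2 ∧ l₄ = c ^ 2)) := by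
    rw [typeTE_iff_roots ha hc hr]
    simp only [hasRoots_ofReal_iff ha hc]
    constructor
    · rintro ⟨t, l, h, ⟨h1, h2, h3⟩ | ⟨h1, h2⟩⟩
      · exact ⟨t, t, l, h, Or.inl ⟨h1, rfl, h2, h3⟩⟩
      · exact ⟨t, t, l, h, Or.inr ⟨h1, h1, h2⟩⟩
    · rintro ⟨t, s, l, h, ⟨h1, rfl, h2, h3⟩ | ⟨h1, rfl, h2⟩⟩
      · exact ⟨t, l, h, Or.inl ⟨h1, h2, h3⟩⟩
      · subst h1
        exact ⟨_, l, h, Or.inr ⟨rfl, h2⟩⟩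
  have hset : quadricSurface (hyperboloidMatrix a c) ∩ quadricSurface (sphereMatrix p r) =
      {q | hypEq a c q = 0 ∧ sphereEq r p q = 0} :=
    Set.ext fun q => mem_inter_quadricSurface ha hc
  refine ⟨?_, ?_, hTI, hTE, ?_, fun hra harc => ⟨?_, ?_, ?_⟩⟩
  · simp only [TypeI, mem_quadricSurface_sphereMatrix, isInteriorPoint_hyperboloidMatrix ha hc,
      hasRoots_ofReal_iff ha hc]
    rw [forall_hypEq_neg_iff ha hc hr, exists_pos_neg_iff ha hc hr]
  · simp only [TypeE, mem_quadricSurface_sphereMatrix, isExteriorPoint_hyperboloidMatrix ha hc,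
      hasRoots_ofReal_iff ha hc]
    rw [forall_hypEq_pos_iff ha hc hr, exists_pos_pos_iff ha hc hr]
  · rw [exists_hasRoots_complex_iff ha hc, TypeC, inContact_iff ha hc, areTangent_iff ha hc hr, hset]
    constructor
    · rintro ⟨hne, hT, hcon⟩
      exact complex_roots_of_contact ha hc hr hne hT fun l₂ l₃ l₄ h h4 hsp =>
        not_isPreconnected_of_roots ha hc h h4 hsp hne hcon.isPreconnected
    · rintro ⟨x, y, l, h, hy, hl⟩
      obtain ⟨h1, h2, h3⟩ := isConnected_inter_of_complex_roots ha hc hr h hy hl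
      exact ⟨h1, h2, h1, h3⟩
  · constructor
    · rintro ⟨hT, hp⟩
      obtain ⟨q, t, hT⟩ := (areTangent_iff ha hc hr).1 hT
      obtain ⟨l, h, hl, h1, h2, h0⟩ := hT.mem_of_small ha hc hr hra harc
      -- Since `-a² < t < c²`, the sign of `t` alone decides on which side the centre lies.
      rcases lt_or_gt_of_ne h0 with ht | ht
      · exact ⟨t, t, l, (hasRoots_ofReal_iff ha hc p _ _ _).2 h, h1, rfl, ht, by linarith⟩
      · have := ((typeTE_iff_roots ha hc hr p).2
          ⟨t, l, h, Or.inl ⟨ht, by linarith, h2⟩⟩).2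
        rw [isExteriorPoint_hyperboloidMatrix ha hc] at this
        rw [isInteriorPoint_hyperboloidMatrix ha hc] at hp
        linarith
    · intro h
      have := hTI.2 h
      exact ⟨this.1.areTangent, this.2⟩
  · constructor
    · rintro ⟨hT, hp⟩
      obtain ⟨q, t, hT⟩ := (areTangent_iff ha hc hr).1 hT
      obtain ⟨l, h, hl, h1, h2, h0⟩ := hT.mem_of_small ha hc hr hra harc
      rcases lt_or_gt_of_ne h0 with ht | ht
      · have := ((typeTI_iff_roots ha hc hr p).2 ⟨t, l, h, h1, ht, by linarith⟩).2
        rw [isInteriorPoint_hyperboloidMatrix ha hc] at this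
        rw [isExteriorPoint_hyperboloidMatrix ha hc] at hp
        linarith
      · exact ⟨t, t, l, (hasRoots_ofReal_iff ha hc p _ _ _).2 h, ht, rfl, by linarith⟩
    · rintro ⟨t, _, l, h, h1, rfl, h2⟩
      rw [hasRoots_ofReal_iff ha hc] at h
      -- Some root is at least `c²`, and `l` is the largest root.
      have hl : c ^ 2 ≤ l := by
        obtain ⟨m, hm, hm0⟩ := exists_root_ge (a := a) (c := c) (r := r) p
        by_contra! hlt
        rw [h] at hm0
        have : 0 < (m - t) * (m - t) * (m - l) :=
          mul_pos (mul_pos (by linarith) (by linarith)) (by linarith)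
        exact this.ne' hm0
      have ht := (le_abs_self t).trans (abs_le_of_double_root ha hc hr h hl)
      have := (typeTE_iff_roots ha hc hr p).2 ⟨t, l, h, Or.inl ⟨h1, h2, by linarith⟩⟩
      exact ⟨this.1.areTangent, this.2⟩
  · rw [exists_hasRoots_complex_iff ha hc, inContact_iff ha hc, areTangent_iff ha hc hr]
    constructor
    · rintro ⟨hne, hT⟩
      refine complex_roots_of_contact ha hc hr hne hT fun l₂ l₃ l₄ h h4 hsp => ?_
      have hprod := mul_roots_eq h
      have har : (a * r) ^ 2 < (a ^ 2) ^ 2 := pow_lt_pow_left₀ (by nlinarith) (by positivity)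
        two_ne_zero
      have har' : (a * r) ^ 2 < (c ^ 2) ^ 2 := pow_lt_pow_left₀ harc (by positivity) two_ne_zero
      -- From `l₂l₃l₄ = a²c²r²` and `l₄ ≥ c²`. The exceptional positions need `l₂l₃` at least `a⁴`
      -- or `c⁴`, too large for a small sphere.
      have hle : l₂ * l₃ ≤ (a * r) ^ 2 := by
        by_contra! hlt
        have h1 : (a * r) ^ 2 * c ^ 2 < l₂ * l₃ * c ^ 2 := mul_lt_mul_of_pos_right hlt hc2
        have h2 : l₂ * l₃ * c ^ 2 ≤ l₂ * l₃ * l₄ :=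
          mul_le_mul_of_nonneg_left h4 ((sq_nonneg _).trans hlt.le)
        linarith
      rcases hsp with ⟨h23, h3⟩ | ⟨h2, h23, -⟩
      · have : a ^ 2 * a ^ 2 ≤ -l₂ * -l₃ :=
          mul_le_mul (by linarith) (by linarith) ha2.le (by linarith)
        linarith
      · have : c ^ 2 * c ^ 2 ≤ l₂ * l₃ := mul_le_mul h2 (by linarith) hc2.le (by linarith)
        linarith
    · rintro ⟨x, y, l, h, hy, hl⟩
      obtain ⟨h1, h2, -⟩ := isConnected_inter_of_complex_roots ha hc hr h hy hl
      exact ⟨h1, h2⟩
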